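/- Let $H$ be a real separable Hilbert space and let $V$ be a densely defined self-adjoint nonnegative operator on $H$ whose inverse is of trace class. Let $(\epsilon_n)$ be a complete orthonormal system of eigenvectors of $V$, $V\epsilon_n=\lambda_n\epsilon_n$, with $0<\lambda_n\uparrow\infty$, and put $w_n=\langle w,\epsilon_n\rangle$ and $Q_t w=e^{-tV}w=\sum_n e^{-\lambda_n t}w_n\epsilon_n$. Let $\gamma>0$ and let $a$ be a bounded self-adjoint operator on $H$ with $\gamma|z|^2\le\langle z,az\rangle\le\gamma^{-1}|z|^2$ for all $z\in H$. Let $P_tf(x)=\mathbb E^x f(X_t)$ be the semigroup of the $H$-valued Ornstein–Uhlenbeck process $dX_t=dW_t-VX_t\,dt$, with $W$ a cylindrical Brownian motion of covariance $a$; that is, under $\mathbb P^x$ the process $X$ is Gaussian with mean $Q_tx$ and $$\operatorname{Cov}(\langle X_s,g\rangle,\langle X_t,h\rangle)=\int_0^{s\wedge t}\langle Q_{s-r}g,\,a\,Q_{t-r}h\rangle\,dr .$$ Let $C_b(H)$ be the space of bounded continuous functions $H\to\mathbb R$ with the supremum norm. For $\alpha\in(0,1)$ put $|f|_{C^\alpha}=\sup_{x\in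 H,\,h\neq0}|f(x+h)-f(x)|\,|h|^{-\alpha}$, and let $C^\alpha$ be the set of $f\in C_b(H)$ with $|f|_{C^\alpha}<\infty$. Let $D_wf$ be the directional derivative of $f$ in the direction $w$. For $t>0$ put $$|w|_t=\Big(\sum_i w_i^2\,h(\lambda_it)\Big)^{1/2},\qquad h(u)=\frac{2u}{e^{2u}-1}\ (u\ne0),\quad h(0)=1 .$$ Then for every $\alpha\in(0,1)$ and $\gamma>0$ there is a constant $c_1=c_1(\alpha,\gamma)>0$ (depending on nothing else) such that for all $f\in C^\alpha$, $u,w\in H$ and $t>0$, the derivatives $D_wP_tf$ and $D_uD_wP_tf$ exist everywhere on $H$ and belong to $C_b(H)$, $$\|D_wP_tf\|_{C_b}\le c_1|w|_t\,|f|_{C^\alpha}\,t^{(\alpha-1)/2}\le c_1|w|\,|f|_{C^\alpha}\,t^{(\alpha-1)/2},$$ and $$\|D_uD_wP_tf\|_{C_b}\le c_1|Q_{t/2}u|_{t/2}\,|w|_{t/2}\,|f|_{C^\alpha}\,t^{\frac\alpha2-1}\le c_1|u|_{t/2}\,|w|_{t/2}\,|f|_{C^\alpha}\,t^{\frac\alpha2-1}\le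 c_1|u|\,|w|\,|f|_{C^\alpha}\,t^{\frac\alpha2-1}.$$ -/

import Mathlib

open MeasureTheory ProbabilityTheory
open scoped NNReal RealInnerProductSpace

namespace OU

noncomputable section

/-! ### Function spaces on a Hilbert space -/

/-- `f ∈ C_b(H)`: `f` is continuous and bounded. -/
def IsCb {H : Type*} [TopologicalSpace H] (f : H → ℝ) : Prop :=
  Continuous f ∧ ∃ C : ℝ, ∀ x, |f x| ≤ C

/-- The supremum norm `‖f‖_{C_b} = sup_x |f x|` (meaningful for `f ∈ C_b(H)`). -/
def supNorm {H : Type*} (f : H → ℝ) : ℝ := ⨆ x, |f x|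

/-- The set of Hölder quotients `|f (x + h) - f x| / |h| ^ α`, for `x ∈ H` and `h ≠ 0`. -/
def holderQuotients {H : Type*} [NormedAddCommGroup H] (α : ℝ) (f : H → ℝ) : Set ℝ :=
  {r | ∃ x h : H, h ≠ 0 ∧ r = |f (x + h) - f x| / ‖h‖ ^ α}

/-- The Hölder seminorm `|f|_{C^α}` (meaningful for `f ∈ C^α`). -/
def holderSeminorm {H : Type*} [NormedAddCommGroup H] (α : ℝ) (f : H → ℝ) : ℝ :=
  sSup (holderQuotients α f)

/-- `f ∈ C^α`: `f ∈ C_b(H)` and its Hölder seminorm is finite. -/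
def MemHolder {H : Type*} [NormedAddCommGroup H] (α : ℝ) (f : H → ℝ) : Prop :=
  IsCb f ∧ BddAbove (holderQuotients α f)

/-- The directional derivative `D_w f`, as a function on `H`. Its value is `0` at the points where
`f` is not differentiable in the direction `w`. -/
def dirDeriv {H : Type*} [NormedAddCommGroup H] [NormedSpace ℝ H] (w : H) (f : H → ℝ) : H → ℝ :=
  fun x => lineDeriv ℝ f x w

/-- `D_w f ∈ C_b(H)`: the directional derivative `D_w f` exists at every point of `H`, and is
continuous and bounded. -/
def DirDerivMemCb {H : Type*} [NormedAddCommGroup H] [NormedSpace ℝ H] (w : H) (f : H → ℝ) :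
    Prop :=
  (∀ x, LineDifferentiableAt ℝ f x w) ∧ IsCb (dirDeriv w f)

/-! ### The operator `V`, its eigenbasis, the semigroup `Q_t` and the weighted norms -/

section Operators

variable {H : Type*} [NormedAddCommGroup H] [InnerProductSpace ℝ H]

/-- A bounded operator on a Hilbert space is of trace class (equivalently, nuclear) if it is a sum
`T z = ∑ n, ⟪x n, z⟫ y n` of operators of rank one with `∑ n, ‖x n‖ ‖y n‖ < ∞`. -/
def IsTraceClass (T : H →L[ℝ] H) : Prop :=
  ∃ x y : ℕ → H, Summable (fun n => ‖x n‖ * ‖y n‖) ∧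
    ∀ z, HasSum (fun n => ⟪x n, z⟫ • y n) (T z)

/-- The (unbounded) operator `V` is a bijection from its domain onto `H`, whose inverse is a bounded
operator of trace class. -/
def HasTraceClassInverse (V : H →ₗ.[ℝ] H) : Prop :=
  ∃ T : H →L[ℝ] H, IsTraceClass T ∧
    (∀ z, ∃ hz : T z ∈ V.domain, V ⟨T z, hz⟩ = z) ∧ ∀ x : V.domain, T (V x) = x

/-- `V` is a (densely defined) self-adjoint nonnegative operator on `H` whose inverse is of trace
class. Note that a self-adjoint partially defined operator is densely defined
(`IsSelfAdjoint.dense_domain`). -/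
structure IsAdmissible [CompleteSpace H] (V : H →ₗ.[ℝ] H) : Prop where
  selfAdjoint : IsSelfAdjoint V
  nonneg : ∀ x : V.domain, 0 ≤ ⟪V x, (x : H)⟫
  traceClass_inverse : HasTraceClassInverse V

/-- The complete orthonormal system `(ε n)` consists of eigenvectors of `V`, with eigenvalues
`lam n` in nondecreasing order. -/
structure IsEigenbasis (V : H →ₗ.[ℝ] H) (ε : HilbertBasis ℕ ℝ H) (lam : ℕ → ℝ) : Prop where
  eigen : ∀ n, ∃ hn : ε n ∈ V.domain, V ⟨ε n, hn⟩ = lam n • ε n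
  mono : Monotone lam

/-- The contraction semigroup `Q_t = exp (-t V)`: `Q_t w = ∑ i, exp (-λ_i t) ⟪ε i, w⟫ ε i`. -/
def Q (ε : HilbertBasis ℕ ℝ H) (lam : ℕ → ℝ) (t : ℝ) (w : H) : H :=
  ∑' i, (Real.exp (-(lam i * t)) * ⟪ε i, w⟫) • ε i

/-- The function `h(u) = 2u / (exp (2u) - 1)` for `u ≠ 0`, `h(0) = 1`. -/
def hfun (u : ℝ) : ℝ := if u = 0 then 1 else 2 * u / (Real.exp (2 * u) - 1)

/-- The weighted norm `|w|_t = (∑ i, w_i² h(λ_i t))^{1/2}`, where `w_i = ⟪ε i, w⟫`. -/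
def wnorm (ε : HilbertBasis ℕ ℝ H) (lam : ℕ → ℝ) (t : ℝ) (w : H) : ℝ :=
  Real.sqrt (∑' i, ⟪ε i, w⟫ ^ 2 * hfun (lam i * t))

/-- The bounded operator `a` is self-adjoint and satisfies the uniform ellipticity bounds
`γ |z|² ≤ ∑ i j, a_ij z_i z_j ≤ γ⁻¹ |z|²`; the double sum is the quadratic form `⟪z, a z⟫`. -/
structure IsElliptic [CompleteSpace H] (γ : ℝ) (a : H →L[ℝ] H) : Prop where
  selfAdjoint : IsSelfAdjoint a
  lower : ∀ z, γ * ‖z‖ ^ 2 ≤ ⟪z, a z⟫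
  upper : ∀ z, ⟪z, a z⟫ ≤ γ⁻¹ * ‖z‖ ^ 2

/-! ### The Ornstein-Uhlenbeck process and its semigroup -/

/-- `(X_t)` under `(P x)` is the `H`-valued Ornstein-Uhlenbeck process `dX_t = dW_t - V X_t dt`,
`X_0 = x`, with `W` a cylindrical Brownian motion of covariance `a`, given through its law: under
`P x` it is the Gaussian process with mean `Q_t x` and with covariance
`Cov(⟪X_s, g⟫, ⟪X_t, h⟫) = ∫_0^{min s t} ⟪Q_{s-r} g, a Q_{t-r} h⟫ dr`.
In particular `X_0 = x` almost surely under `P x`. Continuity of the paths is not required, so that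
the coordinate process on the space of continuous `H`-valued paths is a special case. -/
structure IsOrnsteinUhlenbeck [MeasurableSpace H] (ε : HilbertBasis ℕ ℝ H) (lam : ℕ → ℝ)
    (a : H →L[ℝ] H) {Ω : Type*} [MeasurableSpace Ω] (P : H → Measure Ω) (X : ℝ≥0 → Ω → H) :
    Prop where
  gaussian : ∀ x, IsGaussianProcess X (P x)
  mean : ∀ x t h, ∫ ω, ⟪X t ω, h⟫ ∂(P x) = ⟪x, Q ε lam t h⟫
  cov : ∀ x (s t : ℝ≥0) (g h : H),
    cov[fun ω => ⟪X s ω, g⟫, fun ω => ⟪X t ω, h⟫; P x] =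
      ∫ r in (0 : ℝ)..(min s t : ℝ≥0), ⟪Q ε lam (s - r) g, a (Q ε lam (t - r) h)⟫

/-- The transition semigroup `P_t f (x) = E^x f(X_t)`. -/
def semigroup {Ω : Type*} [MeasurableSpace Ω] (P : H → Measure Ω) (X : ℝ≥0 → Ω → H) (t : ℝ≥0)
    (f : H → ℝ) : H → ℝ :=
  fun x => ∫ ω, f (X t ω) ∂(P x)

end Operators

end

end OU

/-! Under `P x` the variable `X t` has the law of `Q_t x + Y`, where the centered Gaussian law `μ`
of `Y` does not depend on `x` (`semigroup_eq`). So `P_t f` is an average of translates of `f`, and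
differentiating it amounts to shifting `μ` along `Q_t w`. Write `J = innerL2 μ`. If `k = J* z` with
`z` in the closure of the range of `J`, the Cameron-Martin formula moves the derivative along `k`
from `f` to the weight (`hasDerivAt_weightedAvg`): the weight `1` becomes `z`, and then `z'` becomes
`z' z - ⟪z', z⟫`. Diagonalizing `Q_t` and using the lower bound on `a` gives `Q_t w = J* z` with
`‖z‖ ≤ (γ t)^{-1/2} |w|_t` (`exists_adjoint_eq_Q`).

The Hölder gain cannot come from moments of `‖Y‖`, which depend on `V` while the constant may not.
Instead `f` is split at scale `δ` as `(f - g) + g`, with `|f - g| ≤ L δ^α` and `g` Lipschitz with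
constant `L δ^(α-1)` (`exists_lipschitz_approx`). On `f - g` the `L¹` norm of the weight is used. On
`g` the last derivative is kept on the function and costs only the length of `Q_t w`, at most
`|w|_t` (`abs_weightedAvg_affine_mul_sub_le`). The choice `δ = √t` balances the two.

Both derivatives are taken at the single time `t`, without splitting the semigroup. The norms at
time `t / 2` enter through elementary inequalities between `h(u)` and `h(u/2)`. -/

open MeasureTheory ProbabilityTheory
open scoped NNReal RealInnerProductSpace

namespace OU

/-! ### Centered Gaussian measures and the Cameron-Martin formula. -/

section Gaussian

variable {H : Type*} [NormedAddCommGroup H] [InnerProductSpace ℝ H] [CompleteSpace H]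
  [SecondCountableTopology H] [MeasurableSpace H] [BorelSpace H]

/-- The map sending `h` to the class of `y ↦ ⟪h, y⟫` in `L²(μ)`. -/
noncomputable def innerL2 (μ : Measure H) : H →L[ℝ] Lp ℝ 2 μ :=
  (StrongDual.toLp μ 2).comp (innerSL ℝ)

variable (μ : Measure H) [IsGaussian μ]

lemma coeFn_innerL2 (h : H) : innerL2 μ h =ᵐ[μ] fun y => ⟪h, y⟫ := by
  rw [innerL2, ContinuousLinearMap.comp_apply, StrongDual.toLp_apply IsGaussian.memLp_two_id]
  filter_upwards [MemLp.coeFn_toLp (IsGaussian.memLp_two_id.continuousLinearMap_comp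
    (innerSL ℝ h) : MemLp (innerSL ℝ h) 2 μ)] with y hy
  exact hy.trans (by simp)

lemma inner_innerL2 (g h : H) : ⟪innerL2 μ g, innerL2 μ h⟫ = ∫ y, ⟪g, y⟫ * ⟪h, y⟫ ∂μ := by
  rw [L2.inner_def]
  refine integral_congr_ae ?_
  filter_upwards [coeFn_innerL2 μ g, coeFn_innerL2 μ h] with y h1 h2
  simp [h1, h2, mul_comm]

lemma inner_covarianceOperator (g h : H) :
    ⟪covarianceOperator μ g, h⟫ = ⟪innerL2 μ g, innerL2 μ h⟫ := by
  rw [covarianceOperator_inner IsGaussian.memLp_two_id, inner_innerL2]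

variable {μ}

lemma covarianceBilin_eq_inner (h0 : μ[id] = 0) (g h : H) :
    covarianceBilin μ g h = ⟪innerL2 μ g, innerL2 μ h⟫ := by
  rw [covarianceBilin_apply IsGaussian.memLp_two_id, inner_innerL2, h0]
  simp

lemma charFun_centered (h0 : μ[id] = 0) (g : H) :
    charFun μ g = Complex.exp (-(‖innerL2 μ g‖ : ℂ) ^ 2 / 2) := by
  rw [IsGaussian.charFun_eq', covarianceBilin_eq_inner h0, h0, real_inner_self_eq_norm_sq]
  simp [neg_div]

lemma integral_inner_centered (h0 : μ[id] = 0) (h : H) : ∫ y, ⟪h, y⟫ ∂μ = 0 := by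
  have := integral_inner (𝕜 := ℝ) (IsGaussian.integrable_id (μ := μ)) h
  simp only [id_eq] at this h0
  rw [this, h0, inner_zero_right]

lemma variance_inner_centered (h0 : μ[id] = 0) (h : H) :
    Var[fun y => ⟪h, y⟫; μ] = ‖innerL2 μ h‖ ^ 2 := by
  rw [← covarianceBilin_self IsGaussian.memLp_two_id, covarianceBilin_eq_inner h0,
    real_inner_self_eq_norm_sq]

lemma map_inner_centered (h0 : μ[id] = 0) (h : H) :
    μ.map (fun y => ⟪h, y⟫) = gaussianReal 0 (‖innerL2 μ h‖ ^ 2).toNNReal := by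
  have h1 : HasGaussianLaw (fun y : H => ⟪h, y⟫) μ :=
    IsGaussian.hasGaussianLaw_id.map_fun (innerSL ℝ h)
  rw [h1.map_eq_gaussianReal, integral_inner_centered h0, variance_inner_centered h0]

/-- Fernique's theorem, after completing the square in `M ‖y‖ ≤ C ‖y‖² + M² / (4 C)`. -/
lemma integrable_exp_mul_norm (M : ℝ) : Integrable (fun y => Real.exp (M * ‖y‖)) μ := by
  obtain ⟨C, hC, hi⟩ := IsGaussian.exists_integrable_exp_sq μ
  refine (hi.const_mul (Real.exp (M ^ 2 / (4 * C)))).mono' (by fun_prop) ?_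
  filter_upwards with y
  rw [Real.norm_eq_abs, Real.abs_exp, ← Real.exp_add]
  refine Real.exp_le_exp.2 ?_
  have : M ^ 2 / (4 * C) + C * ‖y‖ ^ 2 - M * ‖y‖ = (M - 2 * C * ‖y‖) ^ 2 / (4 * C) := by
    field_simp; ring
  have h2 : 0 ≤ (M - 2 * C * ‖y‖) ^ 2 / (4 * C) := by positivity
  linarith

lemma integrable_exp_inner (h : H) : Integrable (fun y => Real.exp ⟪h, y⟫) μ := by
  refine (integrable_exp_mul_norm (μ := μ) ‖h‖).mono' (by fun_prop) ?_
  filter_upwards with y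
  rw [Real.norm_eq_abs, Real.abs_exp]
  exact Real.exp_le_exp.2 (real_inner_le_norm _ _)

lemma integral_exp_inner (h0 : μ[id] = 0) (h : H) :
    ∫ y, Real.exp ⟪h, y⟫ ∂μ = Real.exp (‖innerL2 μ h‖ ^ 2 / 2) := by
  have := mgf_gaussianReal (map_inner_centered h0 h) 1
  simpa [mgf] using this

/-- The joint characteristic function and moment generating function of two linear functionals. -/
lemma integral_cexp_inner (h0 : μ[id] = 0) (g h : H) :
    ∫ y, Complex.exp (⟪y, g⟫ * Complex.I) * Complex.exp (⟪h, y⟫ : ℂ) ∂μ =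
      Complex.exp (⟪innerL2 μ g, innerL2 μ h⟫ * Complex.I - ‖innerL2 μ g‖ ^ 2 / 2
        + ‖innerL2 μ h‖ ^ 2 / 2) := by
  set J := innerL2 μ
  -- Regression coefficient: `g - c • h` is uncorrelated with `h`, hence independent of it, and the
  -- integral factors. If `J h = 0`, division by zero gives `c = 0`, which is still right because
  -- the covariance vanishes.
  set c : ℝ := ⟪J g, J h⟫ / ‖J h‖ ^ 2 with hc
  have hcm : c * ‖J h‖ ^ 2 = ⟪J g, J h⟫ := by
    by_cases hz : J h = 0
    · simp [hz]
    · rw [hc]; field_simp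
  have hind : IndepFun (fun y : H => ⟪g - c • h, y⟫) (fun y : H => ⟪h, y⟫) μ := by
    refine HasGaussianLaw.indepFun_of_covariance_eq_zero ?_ ?_
    · exact IsGaussian.hasGaussianLaw_id.map_fun
        ((innerSL ℝ (g - c • h)).prod (innerSL ℝ h))
    · rw [← covarianceBilin_apply_eq_cov IsGaussian.memLp_two_id, covarianceBilin_eq_inner h0,
        map_sub, map_smul, inner_sub_left, inner_smul_left, real_inner_self_eq_norm_sq]
      simp only [conj_trivial]
      exact sub_eq_zero.2 hcm.symm
  have h1 : ∀ y : H, Complex.exp (⟪y, g⟫ * Complex.I) * Complex.exp (⟪h, y⟫ : ℂ) =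
      Complex.exp (⟪g - c • h, y⟫ * Complex.I) *
        Complex.exp ((c * Complex.I + 1) * ⟪h, y⟫) := by
    intro y
    rw [← Complex.exp_add, ← Complex.exp_add, inner_sub_left, inner_smul_left,
      real_inner_comm y g]
    congr 1
    push_cast
    simp only [conj_trivial]
    ring
  simp_rw [h1]
  have hind2 := hind.comp (φ := fun r : ℝ => Complex.exp (r * Complex.I))
    (ψ := fun r : ℝ => Complex.exp ((c * Complex.I + 1) * r)) (by fun_prop) (by fun_prop)
  have h2 := hind2.integral_fun_mul_eq_mul_integral
    (by fun_prop) (by fun_prop)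
  simp only [Function.comp_def] at h2
  rw [h2]
  have h3 : ∫ y, Complex.exp (⟪g - c • h, y⟫ * Complex.I) ∂μ =
      Complex.exp (-(‖J (g - c • h)‖ : ℂ) ^ 2 / 2) := by
    rw [← charFun_centered h0, charFun_apply]
    simp_rw [real_inner_comm]
  have h4 := complexMGF_gaussianReal (map_inner_centered h0 h) (c * Complex.I + 1)
  simp only [complexMGF] at h4
  rw [h3, h4, ← Complex.exp_add]
  congr 1
  have h5 : ‖J (g - c • h)‖ ^ 2 = ‖J g‖ ^ 2 - c ^ 2 * ‖J h‖ ^ 2 := by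
    rw [map_sub, map_smul, norm_sub_sq_real, inner_smul_right, norm_smul, mul_pow,
      Real.norm_eq_abs, sq_abs, ← hcm]
    ring
  have h6 : ((‖J h‖ ^ 2).toNNReal : ℂ) = (‖J h‖ : ℂ) ^ 2 := by
    rw [← Complex.ofReal_pow, ← Real.coe_toNNReal (‖J h‖ ^ 2) (by positivity)]
    simp
  have h7 : (‖J (g - c • h)‖ : ℂ) ^ 2 = (‖J g‖ : ℂ) ^ 2 - c ^ 2 * (‖J h‖ : ℂ) ^ 2 := by
    exact_mod_cast congrArg (fun r : ℝ => (r : ℂ)) h5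
  rw [h7, ← hcm]
  change _ + (_ * 0 + ((‖J h‖ ^ 2).toNNReal : ℂ) * _ / 2) = _
  rw [h6]
  push_cast
  linear_combination (‖J h‖ : ℂ) ^ 2 * c ^ 2 / 2 * Complex.I_sq

/-- **Cameron-Martin formula** for shifts in the range of the covariance operator. -/
lemma map_add_covarianceOperator (h0 : μ[id] = 0) (h : H) :
    μ.map (· + covarianceOperator μ h) = μ.tilted (fun y => ⟪h, y⟫) := by
  have := isProbabilityMeasure_tilted (μ := μ) (integrable_exp_inner h)
  have : IsProbabilityMeasure (μ.map (· + covarianceOperator μ h)) :=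
    Measure.isProbabilityMeasure_map (by fun_prop)
  -- The shift multiplies the characteristic function by a phase. The tilt yields the same phase
  -- through the cross term of `integral_cexp_inner`, once the normalizing constant is divided out.
  apply Measure.ext_of_charFun
  ext g
  rw [charFun_map_add_const, charFun_apply (μ := μ.tilted _), integral_tilted, integral_exp_inner h0,
    charFun_centered h0, inner_covarianceOperator]
  have h1 : ∀ y : H, (Real.exp ⟪h, y⟫ / Real.exp (‖innerL2 μ h‖ ^ 2 / 2)) •
      Complex.exp (⟪y, g⟫ * Complex.I) = (Complex.exp (⟪y, g⟫ * Complex.I) *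
        Complex.exp (⟪h, y⟫ : ℂ)) * Complex.exp (-(‖innerL2 μ h‖ ^ 2 / 2)) := by
    intro y
    rw [Complex.real_smul, Complex.exp_neg]
    push_cast
    ring
  simp_rw [h1]
  rw [integral_mul_const, integral_cexp_inner h0, ← Complex.exp_add, ← Complex.exp_add,
    real_inner_comm]
  congr 1
  ring

lemma integral_add_smul_covarianceOperator (h0 : μ[id] = 0) (h : H) (s : ℝ) {F : H → ℝ}
    (hF : Measurable F) :
    ∫ y, F (y + s • covarianceOperator μ h) ∂μ =
      ∫ y, F y * Real.exp (s * ⟪h, y⟫ - s ^ 2 * ‖innerL2 μ h‖ ^ 2 / 2) ∂μ := by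
  have h1 := map_add_covarianceOperator h0 (s • h)
  have h2 : ∫ y, F y ∂(μ.map (· + covarianceOperator μ (s • h))) =
      ∫ y, F y ∂(μ.tilted (fun y => ⟪s • h, y⟫)) := by rw [h1]
  rw [integral_map (by fun_prop) hF.aestronglyMeasurable, integral_tilted,
    integral_exp_inner h0, map_smul] at h2
  rw [h2]
  congr 1 with y
  rw [← Real.exp_sub, map_smul, norm_smul, inner_smul_left, mul_pow, Real.norm_eq_abs, sq_abs]
  simp [mul_comm]

end Gaussian

end OU

namespace OU

/-! ### Averages of translates against integrable weights, and their `L¹` stability. -/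

section WeightedAverage

open Filter Topology

variable {H : Type*} [NormedAddCommGroup H] [MeasurableSpace H]

/-- The average of the translates of `f` against the signed measure with density `φ`. -/
noncomputable def weightedAvg (μ : Measure H) (φ f : H → ℝ) (x : H) : ℝ :=
  ∫ y, f (x + y) * φ y ∂μ

variable {μ : Measure H} {φ ψ f : H → ℝ} {B : ℝ}

lemma abs_weightedAvg_le (hφ : Integrable φ μ) (hB : ∀ x, |f x| ≤ B) (x : H) :
    |weightedAvg μ φ f x| ≤ B * ∫ y, |φ y| ∂μ := by
  rw [weightedAvg, ← integral_const_mul, ← Real.norm_eq_abs]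
  refine norm_integral_le_of_norm_le (hφ.abs.const_mul B) (Eventually.of_forall fun y => ?_)
  rw [norm_mul]
  exact mul_le_mul_of_nonneg_right (hB _) (abs_nonneg _)

variable [SecondCountableTopology H] [BorelSpace H]

lemma integrable_comp_add_mul (hφ : Integrable φ μ) (hf : Continuous f) (hB : ∀ x, |f x| ≤ B)
    (x : H) : Integrable (fun y => f (x + y) * φ y) μ :=
  hφ.bdd_mul (c := B) (by fun_prop) (Eventually.of_forall fun y => hB _)

lemma weightedAvg_sub (hφ : Integrable φ μ) (hψ : Integrable ψ μ) (hf : Continuous f)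
    (hB : ∀ x, |f x| ≤ B) (x : H) :
    weightedAvg μ (fun y => φ y - ψ y) f x = weightedAvg μ φ f x - weightedAvg μ ψ f x := by
  simp only [weightedAvg]
  rw [← integral_sub (integrable_comp_add_mul hφ hf hB x) (integrable_comp_add_mul hψ hf hB x)]
  simp_rw [mul_sub]

lemma weightedAvg_sub_fun {g : H → ℝ} {B' : ℝ} (hφ : Integrable φ μ) (hf : Continuous f)
    (hB : ∀ x, |f x| ≤ B) (hg : Continuous g) (hB' : ∀ x, |g x| ≤ B') (x : H) :
    weightedAvg μ φ (fun x => f x - g x) x = weightedAvg μ φ f x - weightedAvg μ φ g x := by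
  simp only [weightedAvg]
  rw [← integral_sub (integrable_comp_add_mul hφ hf hB x) (integrable_comp_add_mul hφ hg hB' x)]
  simp_rw [sub_mul]

lemma continuous_weightedAvg (hφ : Integrable φ μ) (hf : Continuous f) (hB : ∀ x, |f x| ≤ B) :
    Continuous (weightedAvg μ φ f) := by
  refine continuous_of_dominated (bound := fun y => B * |φ y|)
    (fun x => (integrable_comp_add_mul hφ hf hB x).aestronglyMeasurable)
    (fun x => Eventually.of_forall fun y => ?_) (hφ.abs.const_mul B)
    (Eventually.of_forall fun y => by fun_prop)
  rw [norm_mul]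
  exact mul_le_mul_of_nonneg_right (hB _) (abs_nonneg _)

lemma tendsto_weightedAvg {φn : ℕ → H → ℝ} (hφ : Integrable φ μ) (hφn : ∀ n, Integrable (φn n) μ)
    (hlim : Tendsto (fun n => ∫ y, |φn n y - φ y| ∂μ) atTop (𝓝 0)) (hf : Continuous f)
    (hB : ∀ x, |f x| ≤ B) {xn : ℕ → H} {x : H} (hx : Tendsto xn atTop (𝓝 x)) :
    Tendsto (fun n => weightedAvg μ (φn n) f (xn n)) atTop (𝓝 (weightedAvg μ φ f x)) := by
  have h1 : Tendsto (fun n => weightedAvg μ φ f (xn n)) atTop (𝓝 (weightedAvg μ φ f x)) :=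
    ((continuous_weightedAvg hφ hf hB).tendsto x).comp hx
  have h2 : Tendsto (fun n => weightedAvg μ (fun y => φn n y - φ y) f (xn n)) atTop (𝓝 0) := by
    refine squeeze_zero_norm (fun n => abs_weightedAvg_le ((hφn n).sub hφ) hB (xn n)) ?_
    simpa using hlim.const_mul B
  have h3 := h1.add h2
  rw [add_zero] at h3
  refine h3.congr fun n => ?_
  rw [weightedAvg_sub (hφn n) hφ hf hB]
  ring

variable [NormedSpace ℝ H]

/-- The integrated differentiation formula is stable under `L¹`-limits of the weights. -/
lemma weightedAvg_add_smul_sub_of_tendsto {φn ψn : ℕ → H → ℝ} {kn : ℕ → H} {k : H}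
    (hφ : Integrable φ μ) (hφn : ∀ n, Integrable (φn n) μ)
    (hφl : Tendsto (fun n => ∫ y, |φn n y - φ y| ∂μ) atTop (𝓝 0))
    (hψ : Integrable ψ μ) (hψn : ∀ n, Integrable (ψn n) μ)
    (hψl : Tendsto (fun n => ∫ y, |ψn n y - ψ y| ∂μ) atTop (𝓝 0))
    (hk : Tendsto kn atTop (𝓝 k)) (hf : Continuous f) (hB : ∀ x, |f x| ≤ B) (x : H) (s : ℝ)
    (h : ∀ n, weightedAvg μ (φn n) f (x + s • kn n) - weightedAvg μ (φn n) f x =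
      ∫ r in (0 : ℝ)..s, weightedAvg μ (ψn n) f (x + r • kn n)) :
    weightedAvg μ φ f (x + s • k) - weightedAvg μ φ f x =
      ∫ r in (0 : ℝ)..s, weightedAvg μ ψ f (x + r • k) := by
  have hx : ∀ r : ℝ, Tendsto (fun n => x + r • kn n) atTop (𝓝 (x + r • k)) :=
    fun r => tendsto_const_nhds.add (hk.const_smul r)
  have h1 := (tendsto_weightedAvg hφ hφn hφl hf hB (hx s)).sub
    (tendsto_weightedAvg hφ hφn hφl hf hB (tendsto_const_nhds (x := x)))
  simp_rw [h] at h1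
  refine tendsto_nhds_unique h1 ?_
  have hB0 : 0 ≤ B := (abs_nonneg _).trans (hB 0)
  refine intervalIntegral.tendsto_integral_filter_of_dominated_convergence
    (fun _ => B * (1 + ∫ y, |ψ y| ∂μ)) ?_ ?_ (by simp) ?_
  · refine Eventually.of_forall fun n => Continuous.aestronglyMeasurable ?_
    exact (continuous_weightedAvg (hψn n) hf hB).comp (by fun_prop)
  · filter_upwards [hψl.eventually_le_const (zero_lt_one)] with n hn
    refine Eventually.of_forall fun r _ => (abs_weightedAvg_le (hψn n) hB _).trans ?_
    refine mul_le_mul_of_nonneg_left ?_ hB0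
    calc ∫ y, |ψn n y| ∂μ ≤ ∫ y, (|ψn n y - ψ y| + |ψ y|) ∂μ := by
          refine integral_mono (hψn n).abs (((hψn n).sub hψ).abs.add hψ.abs) fun y => ?_
          simpa using abs_add_le (ψn n y - ψ y) (ψ y)
      _ = _ := integral_add ((hψn n).sub hψ).abs hψ.abs
      _ ≤ _ := by linarith
  · exact Eventually.of_forall fun r _ => tendsto_weightedAvg hψ hψn hψl hf hB (hx r)

end WeightedAverage

/-! ### Differentiation along the range of the covariance operator. -/

section AffineWeight

open Filter Topology

variable {H : Type*} [NormedAddCommGroup H] [InnerProductSpace ℝ H] [CompleteSpace H]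
  [SecondCountableTopology H] [MeasurableSpace H] [BorelSpace H]
  {μ : Measure H} [IsGaussian μ] {f : H → ℝ} {B : ℝ}

lemma integrable_of_abs_le_exp {g : H → ℝ} (hg : AEStronglyMeasurable g μ) (K M : ℝ)
    (h : ∀ y, |g y| ≤ K * Real.exp (M * ‖y‖)) : Integrable g μ :=
  ((integrable_exp_mul_norm M).const_mul K).mono' hg (Eventually.of_forall h)

/-- Domination, uniform in `|s| ≤ 1`, of the `s`-derivative of the shifted affine weight. Each
polynomial factor is absorbed by one `exp n`, whence the exponent `2 + a`. -/
lemma abs_quadratic_exp_le (c κ v s n ξ η : ℝ) (a b : ℝ) (hn : 0 ≤ n) (hv : 0 ≤ v)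
    (hs : |s| ≤ 1) (ha : 0 ≤ a) (hb : 0 ≤ b) (hξ : |ξ| ≤ a * n) (hη : |η| ≤ b * n) :
    |(-κ + (c + η - s * κ) * (ξ - s * v)) * Real.exp (s * ξ - s ^ 2 * v / 2)| ≤
      (|κ| + (|c| + b + |κ|) * (a + v)) * Real.exp ((2 + a) * n) := by
  have hen : 1 + n ≤ Real.exp n := by linarith [Real.add_one_le_exp n]
  have h1n : 1 ≤ Real.exp n := by linarith
  have hnn : n ≤ Real.exp n := by linarith
  have hsκ : |s * κ| ≤ |κ| := by
    rw [abs_mul]; exact mul_le_of_le_one_left (abs_nonneg _) hs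
  have hsv : |s * v| ≤ v := by
    rw [abs_mul, abs_of_nonneg hv]; exact mul_le_of_le_one_left hv hs
  have e1 : |c + η - s * κ| ≤ (|c| + b + |κ|) * Real.exp n := by
    calc |c + η - s * κ| ≤ |c| + |η| + |s * κ| :=
          (abs_sub _ _).trans (by linarith [abs_add_le c η])
      _ ≤ |c| + b * n + |κ| := by linarith
      _ ≤ |c| * Real.exp n + b * Real.exp n + |κ| * Real.exp n := by
          gcongr
          · exact le_mul_of_one_le_right (abs_nonneg _) h1n
          · exact le_mul_of_one_le_right (abs_nonneg _) h1n
      _ = _ := by ring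
  have e2 : |ξ - s * v| ≤ (a + v) * Real.exp n := by
    calc |ξ - s * v| ≤ |ξ| + |s * v| := abs_sub _ _
      _ ≤ a * n + v := by linarith
      _ ≤ a * Real.exp n + v * Real.exp n := by
          gcongr
          exact le_mul_of_one_le_right hv h1n
      _ = _ := by ring
  have e3 : |κ| ≤ |κ| * (Real.exp n * Real.exp n) :=
    le_mul_of_one_le_right (abs_nonneg _) (one_le_mul_of_one_le_of_one_le h1n h1n)
  have e4 : Real.exp (s * ξ - s ^ 2 * v / 2) ≤ Real.exp (a * n) := by
    refine Real.exp_le_exp.2 ?_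
    have : s * ξ ≤ |ξ| := (le_abs_self _).trans (by
      rw [abs_mul]; exact mul_le_of_le_one_left (abs_nonneg _) hs)
    have : 0 ≤ s ^ 2 * v / 2 := by positivity
    linarith
  rw [abs_mul, Real.abs_exp]
  calc _ ≤ (|κ| * (Real.exp n * Real.exp n) +
        (|c| + b + |κ|) * Real.exp n * ((a + v) * Real.exp n)) * Real.exp (a * n) := by
        refine mul_le_mul ?_ e4 (Real.exp_nonneg _) (by positivity)
        refine (abs_add_le _ _).trans ?_
        rw [abs_neg, abs_mul]
        exact add_le_add e3 (mul_le_mul e1 e2 (abs_nonneg _) (by positivity))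
    _ = (|κ| + (|c| + b + |κ|) * (a + v)) * (Real.exp n * Real.exp n * Real.exp (a * n)) := by
        ring
    _ = _ := by
        rw [← Real.exp_add, ← Real.exp_add]
        congr 2
        ring

lemma integrable_affine_mul_inner (c κ : ℝ) (h h' : H) :
    Integrable (fun y => (c + ⟪h', y⟫) * ⟪h, y⟫ - κ) μ := by
  refine integrable_of_abs_le_exp (by fun_prop)
    (|κ| + (|c| + ‖h'‖ + |κ|) * (‖h‖ + 0)) (2 + ‖h‖) fun y => ?_
  · have := abs_quadratic_exp_le c κ 0 0 ‖y‖ ⟪h, y⟫ ⟪h', y⟫ ‖h‖ ‖h'‖ (norm_nonneg _) le_rfl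
      (by simp) (norm_nonneg _) (norm_nonneg _) (abs_real_inner_le_norm _ _)
      (abs_real_inner_le_norm _ _)
    refine le_trans (le_of_eq ?_) this
    simp only [zero_mul, sub_zero, zero_pow, ne_eq, OfNat.ofNat_ne_zero, not_false_eq_true,
      zero_div, Real.exp_zero, mul_one]
    congr 1
    ring

lemma integrable_affine (c : ℝ) (h' : H) : Integrable (fun y => c + ⟪h', y⟫) μ := by
  have h1 : Integrable (fun y => ⟪h', y⟫) μ := by
    simpa using integrable_affine_mul_inner (μ := μ) 1 0 h' 0
  exact (integrable_const c).add h1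

/-- Differentiation of a weighted average with affine weight along the range of the covariance. -/
lemma hasDerivAt_weightedAvg_affine (h0 : μ[id] = 0) (hf : Continuous f) (hB : ∀ x, |f x| ≤ B)
    (c : ℝ) (h h' x : H) :
    HasDerivAt (fun s : ℝ => weightedAvg μ (fun y => c + ⟪h', y⟫) f
        (x + s • covarianceOperator μ h))
      (weightedAvg μ (fun y => (c + ⟪h', y⟫) * ⟪h, y⟫ - ⟪innerL2 μ h', innerL2 μ h⟫) f x) 0 := by
  set κ := ⟪innerL2 μ h', innerL2 μ h⟫ with hκ
  set v := ‖innerL2 μ h‖ ^ 2 with hv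
  have hv0 : 0 ≤ v := by positivity
  have hB0 : 0 ≤ B := (abs_nonneg _).trans (hB 0)
  have key : ∀ s : ℝ, weightedAvg μ (fun y => c + ⟪h', y⟫) f (x + s • covarianceOperator μ h) =
      ∫ y, f (x + y) * ((c + ⟪h', y⟫ - s * κ) * Real.exp (s * ⟪h, y⟫ - s ^ 2 * v / 2)) ∂μ := by
    intro s
    -- The correction `- s * κ` cancels the change of `⟪h', y⟫` under the shift. After the change of
    -- variables `f` no longer sees `s`, so no smoothness of `f` is needed to differentiate.
    have := integral_add_smul_covarianceOperator h0 h s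
      (F := fun y => f (x + y) * (c + ⟪h', y⟫ - s * κ))
      (((hf.comp (by fun_prop)).mul (by fun_prop)).measurable)
    simp only [mul_assoc] at this
    rw [← this, weightedAvg]
    congr 1 with y
    rw [inner_add_right, inner_smul_right, real_inner_comm (covarianceOperator μ h) h',
      inner_covarianceOperator, real_inner_comm (innerL2 μ h'), ← hκ, add_right_comm x,
      add_assoc x y]
    ring
  have hmain := hasDerivAt_integral_of_dominated_loc_of_deriv_le (μ := μ) (𝕜 := ℝ)
    (s := Metric.closedBall 0 1) (x₀ := (0 : ℝ))
    (F := fun s y => f (x + y) *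
      ((c + ⟪h', y⟫ - s * κ) * Real.exp (s * ⟪h, y⟫ - s ^ 2 * v / 2)))
    (F' := fun s y => f (x + y) * ((-κ + (c + ⟪h', y⟫ - s * κ) * (⟪h, y⟫ - s * v)) *
      Real.exp (s * ⟪h, y⟫ - s ^ 2 * v / 2)))
    (bound := fun y => B * ((|κ| + (|c| + ‖h'‖ + |κ|) * (‖h‖ + v)) *
      Real.exp ((2 + ‖h‖) * ‖y‖)))
    (Metric.closedBall_mem_nhds _ one_pos)
    (Eventually.of_forall fun s => by
      have : Continuous fun y => f (x + y) := hf.comp (by fun_prop)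
      fun_prop)
    (by
      simpa using integrable_comp_add_mul (integrable_affine c h') hf hB x)
    (by
      have : Continuous fun y => f (x + y) := hf.comp (by fun_prop)
      fun_prop)
    (Eventually.of_forall fun y s hs => by
      rw [norm_mul]
      refine mul_le_mul (hB _) ?_ (norm_nonneg _) hB0
      exact abs_quadratic_exp_le c κ v s ‖y‖ ⟪h, y⟫ ⟪h', y⟫ ‖h‖ ‖h'‖ (norm_nonneg _) hv0
        (by simpa using hs) (norm_nonneg _) (norm_nonneg _) (abs_real_inner_le_norm _ _)
        (abs_real_inner_le_norm _ _))
    (((integrable_exp_mul_norm _).const_mul _).const_mul B)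
    (Eventually.of_forall fun y s _ => by
      have e1 : HasDerivAt (fun s : ℝ => c + ⟪h', y⟫ - s * κ) (-κ) s := by
        simpa using ((hasDerivAt_id s).mul_const κ).const_sub (c + ⟪h', y⟫)
      have e2 : HasDerivAt (fun s : ℝ => s * ⟪h, y⟫ - s ^ 2 * v / 2) (⟪h, y⟫ - s * v) s := by
        refine (((hasDerivAt_id' s).mul_const ⟪h, y⟫).sub
          (((hasDerivAt_pow 2 s).mul_const v).div_const 2)).congr_deriv ?_
        norm_num
        ring
      exact ((e1.mul e2.exp).const_mul (f (x + y))).congr_deriv (by ring))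
  have h2 := hmain.2
  simp_rw [← key] at h2
  refine h2.congr_deriv ?_
  rw [weightedAvg]
  congr 1 with y
  simp
  left
  ring

/-- The integrated form, unlike a pointwise derivative, survives limits in both the weights and the
direction; this allows passage to the whole Cameron-Martin space. -/
lemma weightedAvg_affine_add_smul_sub (h0 : μ[id] = 0) (hf : Continuous f)
    (hB : ∀ x, |f x| ≤ B) (c : ℝ) (h h' x : H) (s : ℝ) :
    weightedAvg μ (fun y => c + ⟪h', y⟫) f (x + s • covarianceOperator μ h) -
        weightedAvg μ (fun y => c + ⟪h', y⟫) f x =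
      ∫ r in (0 : ℝ)..s, weightedAvg μ
        (fun y => (c + ⟪h', y⟫) * ⟪h, y⟫ - ⟪innerL2 μ h', innerL2 μ h⟫) f
        (x + r • covarianceOperator μ h) := by
  have hd : ∀ r : ℝ, HasDerivAt (fun s : ℝ => weightedAvg μ (fun y => c + ⟪h', y⟫) f
      (x + s • covarianceOperator μ h)) (weightedAvg μ
        (fun y => (c + ⟪h', y⟫) * ⟪h, y⟫ - ⟪innerL2 μ h', innerL2 μ h⟫) f
        (x + r • covarianceOperator μ h)) r := by
    intro r
    have h1 := hasDerivAt_weightedAvg_affine h0 hf hB c h h' (x + r • covarianceOperator μ h)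
    rw [← sub_self r] at h1
    have h2 := h1.comp_sub_const r r
    simpa only [sub_smul, add_add_sub_cancel] using h2
  rw [intervalIntegral.integral_eq_sub_of_hasDerivAt (fun r _ => hd r)]
  · simp
  · refine Continuous.intervalIntegrable ?_ _ _
    exact (continuous_weightedAvg (integrable_affine_mul_inner c _ h h') hf hB).comp (by fun_prop)

end AffineWeight

end OU

/-! ### Representation of Cameron-Martin vectors, and integration by parts along them. -/

namespace OU

open Filter Topology

/-- A vector `k` such that `|⟪k, h⟫| ≤ σ ‖J h‖` is the image under the adjoint of `J` of a vector
of norm at most `σ` in the closure of the range of `J`. -/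
lemma exists_mem_closure_range_adjoint_eq {E F : Type*} [NormedAddCommGroup E]
    [InnerProductSpace ℝ E] [CompleteSpace E] [NormedAddCommGroup F] [InnerProductSpace ℝ F]
    [CompleteSpace F] (J : E →L[ℝ] F) {k : E} {σ : ℝ} (hσ : 0 ≤ σ)
    (hk : ∀ h, |⟪k, h⟫| ≤ σ * ‖J h‖) :
    ∃ z ∈ closure (Set.range J), ‖z‖ ≤ σ ∧ J.adjoint z = k := by
  have hker : J.toLinearMap.ker ≤ (innerSL ℝ k).toLinearMap.ker := by
    intro h hh
    have h1 : J h = 0 := hh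
    have h2 := hk h
    rw [h1, norm_zero, mul_zero] at h2
    exact abs_nonpos_iff.1 h2
  -- The bound makes `⟪k, ·⟫` vanish on the kernel of `J`, so it descends to a functional on the
  -- range, of norm at most `σ`; Hahn-Banach and Riesz then represent it.
  let l : J.toLinearMap.range →ₗ[ℝ] ℝ :=
    (J.toLinearMap.ker.liftQ (innerSL ℝ k).toLinearMap hker) ∘ₗ
      J.toLinearMap.quotKerEquivRange.symm.toLinearMap
  have hl : ∀ h : E, l ⟨J h, h, rfl⟩ = ⟪k, h⟫ := by
    intro h
    have h1 : J.toLinearMap.quotKerEquivRange.symm ⟨J h, h, rfl⟩ = Submodule.Quotient.mk h := by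
      rw [LinearEquiv.symm_apply_eq]
      rfl
    change (J.toLinearMap.ker.liftQ (innerSL ℝ k).toLinearMap hker)
      (J.toLinearMap.quotKerEquivRange.symm ⟨J h, h, rfl⟩) = _
    rw [h1]
    rfl
  have hlb : ∀ x, ‖l x‖ ≤ σ * ‖x‖ := by
    rintro ⟨_, h, rfl⟩
    exact (congrArg _ (hl h)).trans_le (hk h)
  obtain ⟨g, hg, hgn⟩ := exists_extension_norm_eq _ (l.mkContinuous σ hlb)
  let z₀ := (InnerProductSpace.toDual ℝ F).symm g
  have hz₀ : ∀ x, ⟪z₀, x⟫ = g x := fun x => InnerProductSpace.toDual_symm_apply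
  -- Projecting onto the closed range leaves every pairing with `J h` unchanged and does not
  -- increase the norm.
  let K := J.toLinearMap.range.topologicalClosure
  refine ⟨K.starProjection z₀, ?_, ?_, ?_⟩
  · exact K.starProjection_apply_mem z₀
  · refine (K.norm_starProjection_apply_le z₀).trans ?_
    rw [LinearIsometryEquiv.norm_map, hgn]
    exact LinearMap.mkContinuous_norm_le _ hσ _
  · refine ext_inner_right ℝ fun h => ?_
    have hJ : J h ∈ K := Submodule.le_topologicalClosure _ ⟨h, rfl⟩
    rw [ContinuousLinearMap.adjoint_inner_left, K.inner_starProjection_left_eq_right,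
      K.starProjection_eq_self_iff.2 hJ, hz₀]
    exact (hg ⟨J h, h, rfl⟩).trans (hl h)

section SquareIntegrable

variable {Ω : Type*} [MeasurableSpace Ω] {μ : Measure Ω}

lemma integrable_mul_Lp_two (a b : Lp ℝ 2 μ) : Integrable (fun y => a y * b y) μ :=
  (Lp.memLp a).integrable_mul (Lp.memLp b)

lemma integral_abs_mul_le_norm_mul_norm (a b : Lp ℝ 2 μ) :
    ∫ y, |a y * b y| ∂μ ≤ ‖a‖ * ‖b‖ := by
  have h : ∫ y, |a y * b y| ∂μ = ⟪|a|, |b|⟫ := by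
    rw [L2.inner_def]
    refine integral_congr_ae ?_
    filter_upwards [Lp.coeFn_abs a, Lp.coeFn_abs b] with y h1 h2
    simp [h1, h2, abs_mul, mul_comm]
  rw [h]
  simpa [norm_abs_eq_norm] using real_inner_le_norm |a| |b|

variable [IsProbabilityMeasure μ]

lemma integrable_Lp_two (a : Lp ℝ 2 μ) : Integrable (fun y => a y) μ :=
  (Lp.memLp a).integrable (by norm_num)

lemma integral_abs_le_norm (a : Lp ℝ 2 μ) : ∫ y, |a y| ∂μ ≤ ‖a‖ := by
  have h := integral_abs_mul_le_norm_mul_norm a (Lp.const 2 μ (1 : ℝ))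
  have h1 : ‖Lp.const 2 μ (1 : ℝ)‖ ≤ 1 := (Lp.norm_const_le ..).trans (by simp)
  have h2 : ∫ y, |a y * Lp.const 2 μ (1 : ℝ) y| ∂μ = ∫ y, |a y| ∂μ := by
    refine integral_congr_ae ?_
    filter_upwards [Lp.coeFn_const 2 μ (1 : ℝ)] with y hy
    rw [hy, Function.const_apply, mul_one]
  rw [h2] at h
  exact h.trans (mul_le_of_le_one_right (norm_nonneg _) h1)

lemma integrable_affine_mul_sub_inner (c : ℝ) (a b : Lp ℝ 2 μ) :
    Integrable (fun y => (c + a y) * b y - ⟪a, b⟫) μ := by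
  simp_rw [add_mul]
  exact (((integrable_Lp_two b).const_mul c).add (integrable_mul_Lp_two a b)).sub
    (integrable_const _)

lemma integral_abs_affine_mul_sub_inner_le (c : ℝ) (a b : Lp ℝ 2 μ) :
    ∫ y, |(c + a y) * b y - ⟪a, b⟫| ∂μ ≤ |c| * ‖b‖ + 2 * (‖a‖ * ‖b‖) := by
  have i1 := (integrable_Lp_two b).abs.const_mul |c|
  have i2 := (integrable_mul_Lp_two a b).abs
  calc ∫ y, |(c + a y) * b y - ⟪a, b⟫| ∂μ
      ≤ ∫ y, (|c| * |b y| + |a y * b y| + |⟪a, b⟫|) ∂μ := by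
        refine integral_mono (integrable_affine_mul_sub_inner c a b).abs
          ((i1.add i2).add (integrable_const _)) fun y => ?_
        refine (abs_sub _ _).trans ?_
        rw [add_mul, ← abs_mul]
        exact add_le_add_left (abs_add_le _ _) _
    _ = |c| * ∫ y, |b y| ∂μ + ∫ y, |a y * b y| ∂μ + |⟪a, b⟫| := by
        have i3 : Integrable (fun y => |c| * |b y| + |a y * b y|) μ := i1.add i2
        rw [integral_add i3 (integrable_const _), integral_add i1 i2, integral_const_mul]
        simp
    _ ≤ _ := by
        have h1 := mul_le_mul_of_nonneg_left (integral_abs_le_norm b) (abs_nonneg c)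
        have h2 := integral_abs_mul_le_norm_mul_norm a b
        have h3 := abs_real_inner_le_norm a b
        linarith

lemma tendsto_integral_abs_affine_sub (c : ℝ) {an : ℕ → Lp ℝ 2 μ} {a : Lp ℝ 2 μ}
    (ha : Tendsto an atTop (𝓝 a)) :
    Tendsto (fun n => ∫ y, |(c + an n y) - (c + a y)| ∂μ) atTop (𝓝 0) := by
  refine squeeze_zero (fun n => integral_nonneg fun y => abs_nonneg _) (fun n => ?_)
    (tendsto_iff_norm_sub_tendsto_zero.1 ha)
  refine le_trans (le_of_eq (integral_congr_ae ?_)) (integral_abs_le_norm (an n - a))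
  filter_upwards [Lp.coeFn_sub (an n) a] with y hy
  rw [hy, Pi.sub_apply, add_sub_add_left_eq_sub]

/-- The weight is affine in the first factor and linear in the second, so the difference splits into
a weight built from `an - a` and `bn` (constant part `0`) and one built from `a` and `bn - b`. Each
is small by `integral_abs_affine_mul_sub_inner_le`. -/
lemma tendsto_integral_abs_affine_mul_sub (c : ℝ) {an bn : ℕ → Lp ℝ 2 μ} {a b : Lp ℝ 2 μ}
    (ha : Tendsto an atTop (𝓝 a)) (hb : Tendsto bn atTop (𝓝 b)) :
    Tendsto (fun n => ∫ y, |((c + an n y) * bn n y - ⟪an n, bn n⟫) -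
      ((c + a y) * b y - ⟪a, b⟫)| ∂μ) atTop (𝓝 0) := by
  have ha' := tendsto_iff_norm_sub_tendsto_zero.1 ha
  have hb' := tendsto_iff_norm_sub_tendsto_zero.1 hb
  have hlim : Tendsto (fun n => (0 * ‖bn n‖ + 2 * (‖an n - a‖ * ‖bn n‖)) +
      (|c| * ‖bn n - b‖ + 2 * (‖a‖ * ‖bn n - b‖))) atTop (𝓝 0) := by
    have := ((hb.norm.const_mul 0).add ((ha'.mul hb.norm).const_mul 2)).add
      ((hb'.const_mul |c|).add ((hb'.const_mul ‖a‖).const_mul 2))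
    simpa using this
  refine squeeze_zero (fun n => integral_nonneg fun y => abs_nonneg _) (fun n => ?_) hlim
  have h1 := integral_abs_affine_mul_sub_inner_le 0 (an n - a) (bn n)
  have h2 := integral_abs_affine_mul_sub_inner_le c a (bn n - b)
  rw [abs_zero] at h1
  refine le_trans ?_ (add_le_add h1 h2)
  have i1 := (integrable_affine_mul_sub_inner 0 (an n - a) (bn n)).abs
  have i2 := (integrable_affine_mul_sub_inner c a (bn n - b)).abs
  rw [← integral_add i1 i2]
  refine integral_mono_ae ((integrable_affine_mul_sub_inner c (an n) (bn n)).sub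
    (integrable_affine_mul_sub_inner c a b)).abs (i1.add i2) ?_
  filter_upwards [Lp.coeFn_sub (an n) a, Lp.coeFn_sub (bn n) b] with y h3 h4
  refine le_trans (le_of_eq ?_) (abs_add_le _ _)
  rw [h3, h4, Pi.sub_apply, Pi.sub_apply, inner_sub_left, inner_sub_right]
  congr 1
  ring

end SquareIntegrable

lemma weightedAvg_congr {H : Type*} [NormedAddCommGroup H] [MeasurableSpace H] {μ : Measure H}
    {φ ψ f : H → ℝ} (h : φ =ᵐ[μ] ψ) : weightedAvg μ φ f = weightedAvg μ ψ f := by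
  ext x
  refine integral_congr_ae ?_
  filter_upwards [h] with y hy
  rw [hy]

section Gaussian

variable {H : Type*} [NormedAddCommGroup H] [InnerProductSpace ℝ H] [CompleteSpace H]
  [SecondCountableTopology H] [MeasurableSpace H] [BorelSpace H]
  {μ : Measure H} [IsGaussian μ] {f : H → ℝ} {B : ℝ}

lemma adjoint_innerL2_innerL2 (h : H) :
    (innerL2 μ).adjoint (innerL2 μ h) = covarianceOperator μ h := by
  refine ext_inner_right ℝ fun g => ?_
  rw [ContinuousLinearMap.adjoint_inner_left, inner_covarianceOperator]

/-- **Integration by parts** for a centered Gaussian measure, with an affine weight, along a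
direction of its Cameron-Martin space. -/
theorem weightedAvg_add_smul_adjoint_sub (h0 : μ[id] = 0) (hf : Continuous f)
    (hB : ∀ x, |f x| ≤ B) (c : ℝ) {z z' : Lp ℝ 2 μ} (hz : z ∈ closure (Set.range (innerL2 μ)))
    (hz' : z' ∈ closure (Set.range (innerL2 μ))) (x : H) (s : ℝ) :
    weightedAvg μ (fun y => c + z' y) f (x + s • (innerL2 μ).adjoint z) -
        weightedAvg μ (fun y => c + z' y) f x =
      ∫ r in (0 : ℝ)..s, weightedAvg μ (fun y => (c + z' y) * z y - ⟪z', z⟫) f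
        (x + r • (innerL2 μ).adjoint z) := by
  obtain ⟨b, hb, hbl⟩ := mem_closure_iff_seq_limit.1 hz
  obtain ⟨a, ha, hal⟩ := mem_closure_iff_seq_limit.1 hz'
  choose h hh using hb
  choose h' hh' using ha
  obtain rfl : b = fun n => innerL2 μ (h n) := funext fun n => (hh n).symm
  obtain rfl : a = fun n => innerL2 μ (h' n) := funext fun n => (hh' n).symm
  have ic : ∀ a : Lp ℝ 2 μ, Integrable (fun y => c + a y) μ := fun a =>
    (integrable_const c).add (integrable_Lp_two a)
  refine weightedAvg_add_smul_sub_of_tendsto (ic z') (fun n => ic _)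
    (tendsto_integral_abs_affine_sub c hal) (integrable_affine_mul_sub_inner c z' z)
    (fun n => integrable_affine_mul_sub_inner c _ _)
    (tendsto_integral_abs_affine_mul_sub c hal hbl)
    (((innerL2 μ).adjoint.continuous.tendsto z).comp hbl) hf hB x s fun n => ?_
  have e1 : (fun y => c + innerL2 μ (h' n) y) =ᵐ[μ] fun y => c + ⟪h' n, y⟫ := by
    filter_upwards [coeFn_innerL2 μ (h' n)] with y hy
    rw [hy]
  have e2 : (fun y => (c + innerL2 μ (h' n) y) * innerL2 μ (h n) y -
        ⟪innerL2 μ (h' n), innerL2 μ (h n)⟫) =ᵐ[μ]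
      fun y => (c + ⟪h' n, y⟫) * ⟪h n, y⟫ - ⟪innerL2 μ (h' n), innerL2 μ (h n)⟫ := by
    filter_upwards [coeFn_innerL2 μ (h' n), coeFn_innerL2 μ (h n)] with y hy hy'
    rw [hy, hy']
  rw [weightedAvg_congr e1, weightedAvg_congr e2]
  simp only [Function.comp_apply, adjoint_innerL2_innerL2]
  exact weightedAvg_affine_add_smul_sub h0 hf hB c (h n) (h' n) x s

/-- The integrand of the integrated formula is continuous in `r`, so the fundamental theorem of
calculus applies. -/
theorem hasDerivAt_weightedAvg (h0 : μ[id] = 0) (hf : Continuous f)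
    (hB : ∀ x, |f x| ≤ B) (c : ℝ) {z z' : Lp ℝ 2 μ} (hz : z ∈ closure (Set.range (innerL2 μ)))
    (hz' : z' ∈ closure (Set.range (innerL2 μ))) (x : H) :
    HasDerivAt
      (fun s : ℝ => weightedAvg μ (fun y => c + z' y) f (x + s • (innerL2 μ).adjoint z))
      (weightedAvg μ (fun y => (c + z' y) * z y - ⟪z', z⟫) f x) 0 := by
  have hc : Continuous fun r : ℝ => weightedAvg μ (fun y => (c + z' y) * z y - ⟪z', z⟫) f
      (x + r • (innerL2 μ).adjoint z) :=
    (continuous_weightedAvg (integrable_affine_mul_sub_inner c z' z) hf hB).comp (by fun_prop)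
  have h1 := (hc.integral_hasStrictDerivAt 0 0).hasDerivAt
  simp_rw [← weightedAvg_add_smul_adjoint_sub h0 hf hB c hz hz' x] at h1
  simpa using h1.add_const (weightedAvg μ (fun y => c + z' y) f x)

end Gaussian

end OU

/-! ### Interpolation between bounded and Lipschitz functions. -/

namespace OU

open Filter Topology

/-- For `r ≤ δ` the first term suffices; for `r ≥ δ` the second does, since `r ^ (α - 1) ≤ δ ^ (α -
1)`. -/
lemma rpow_le_add_mul {α δ r : ℝ} (hα0 : 0 ≤ α) (hα1 : α ≤ 1) (hδ : 0 < δ) (hr : 0 ≤ r) :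
    r ^ α ≤ δ ^ α + δ ^ (α - 1) * r := by
  rcases le_total r δ with h | h
  · have h1 := Real.rpow_le_rpow hr h hα0
    have h2 : 0 ≤ δ ^ (α - 1) * r := by positivity
    linarith
  · have hr' : 0 < r := hδ.trans_le h
    have h1 : r ^ α = r ^ (α - 1) * r := by
      rw [← Real.rpow_add_one hr'.ne', sub_add_cancel]
    have h2 := Real.rpow_le_rpow_of_nonpos hδ h (sub_nonpos.2 hα1)
    have h3 : 0 ≤ δ ^ α := by positivity
    rw [h1]
    linarith [mul_le_mul_of_nonneg_right h2 hr]

/-- A Hölder function is uniformly approximated by Lipschitz functions, by infimal convolution. -/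
lemma exists_lipschitz_approx {E : Type*} [NormedAddCommGroup E] {f : E → ℝ} {B L α δ : ℝ}
    (hα0 : 0 ≤ α) (hα1 : α ≤ 1) (hδ : 0 < δ) (hL : 0 ≤ L) (hB : ∀ x, |f x| ≤ B)
    (hf : ∀ x y, |f x - f y| ≤ L * ‖x - y‖ ^ α) :
    ∃ g : E → ℝ, (∀ x, |g x| ≤ B) ∧ (∀ x y, |g x - g y| ≤ L * δ ^ (α - 1) * ‖x - y‖) ∧
      ∀ x, |f x - g x| ≤ L * δ ^ α := by
  set K := L * δ ^ (α - 1) with hK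
  have hK0 : 0 ≤ K := by positivity
  have hlow : ∀ x y, -B ≤ f y + K * ‖x - y‖ := fun x y => by
    have := (abs_le.1 (hB y)).1
    have : 0 ≤ K * ‖x - y‖ := by positivity
    linarith
  have hbdd : ∀ x, BddBelow (Set.range fun y => f y + K * ‖x - y‖) := fun x =>
    ⟨-B, by rintro _ ⟨y, rfl⟩; exact hlow x y⟩
  set g : E → ℝ := fun x => ⨅ y, f y + K * ‖x - y‖ with hg
  have hgf : ∀ x, g x ≤ f x := fun x => by simpa using ciInf_le (hbdd x) x
  have hlip : ∀ x y, g x ≤ g y + K * ‖x - y‖ := fun x y => by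
    rw [← sub_le_iff_le_add]
    refine le_ciInf fun w => ?_
    have h1 := ciInf_le (hbdd x) w
    have h2 : ‖x - w‖ ≤ ‖x - y‖ + ‖y - w‖ := norm_sub_le_norm_sub_add_norm_sub x y w
    have h3 := mul_le_mul_of_nonneg_left h2 hK0
    simp only [hg]
    linarith
  refine ⟨g, fun x => abs_le.2 ⟨le_ciInf fun y => hlow x y,
    (hgf x).trans (abs_le.1 (hB x)).2⟩, fun x y => ?_, fun x => ?_⟩
  · rw [abs_sub_le_iff]
    have h1 := hlip x y
    have h2 := hlip y x
    rw [norm_sub_rev] at h2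
    exact ⟨by linarith, by linarith⟩
  · rw [abs_of_nonneg (sub_nonneg.2 (hgf x)), sub_le_comm]
    refine le_ciInf fun y => ?_
    have h1 := (abs_le.1 (hf x y)).2
    have h2 := mul_le_mul_of_nonneg_left
      (rpow_le_add_mul hα0 hα1 hδ (norm_nonneg (x - y))) hL
    rw [mul_add, ← mul_assoc] at h2
    linarith

section Gaussian

variable {H : Type*} [NormedAddCommGroup H] [InnerProductSpace ℝ H] [CompleteSpace H]
  [SecondCountableTopology H] [MeasurableSpace H] [BorelSpace H]
  {μ : Measure H} [IsGaussian μ] {f : H → ℝ} {B : ℝ}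

/-- The average on the left is the derivative along `k` of an average with affine weight. Its
increments can be read on `f`, where a shift by `s • k` costs at most `K |s| ‖k‖`. Thus `‖k‖`
replaces `‖z‖`, and no moment of `‖y‖` appears. -/
lemma abs_weightedAvg_affine_mul_sub_le_of_lipschitz (h0 : μ[id] = 0)
    {K : ℝ} (hK : 0 ≤ K) (hB : ∀ x, |f x| ≤ B) (hf : ∀ x y, |f x - f y| ≤ K * ‖x - y‖)
    (c : ℝ) {z z' : Lp ℝ 2 μ} (hz : z ∈ closure (Set.range (innerL2 μ)))
    (hz' : z' ∈ closure (Set.range (innerL2 μ))) (x : H) :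
    |weightedAvg μ (fun y => (c + z' y) * z y - ⟪z', z⟫) f x| ≤
      K * ‖(innerL2 μ).adjoint z‖ * (|c| + ‖z'‖) := by
  set k := (innerL2 μ).adjoint z
  have hc : Continuous f :=
    (LipschitzWith.of_dist_le_mul (K := K.toNNReal) fun x y => by
      rw [Real.coe_toNNReal K hK, Real.dist_eq, dist_eq_norm]
      exact hf x y).continuous
  have ic : Integrable (fun y => c + z' y) μ := (integrable_const c).add (integrable_Lp_two z')
  have hic : ∫ y, |c + z' y| ∂μ ≤ |c| + ‖z'‖ := by
    calc ∫ y, |c + z' y| ∂μ ≤ ∫ y, (|c| + |z' y|) ∂μ :=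
          integral_mono ic.abs ((integrable_const _).add (integrable_Lp_two z').abs)
            fun y => abs_add_le _ _
      _ = |c| + ∫ y, |z' y| ∂μ := by
          rw [integral_add (integrable_const _) (integrable_Lp_two z').abs]
          simp
      _ ≤ _ := by linarith [integral_abs_le_norm z']
  refine (hasDerivAt_weightedAvg h0 hc hB c hz hz' x).le_of_lip' (by positivity)
    (Eventually.of_forall fun s => ?_)
  have h1 : weightedAvg μ (fun y => c + z' y) f (x + s • k) -
      weightedAvg μ (fun y => c + z' y) f (x + (0 : ℝ) • k) =
      weightedAvg μ (fun y => c + z' y) (fun w => f (w + s • k) - f w) x := by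
    rw [weightedAvg_sub_fun ic (by fun_prop) (fun w => hB _) hc hB, zero_smul, add_zero]
    simp only [weightedAvg, add_right_comm]
  have h2 : ∀ w, |f (w + s • k) - f w| ≤ K * (|s| * ‖k‖) := fun w => by
    simpa [norm_smul] using hf (w + s • k) w
  rw [Real.norm_eq_abs, h1, sub_zero, Real.norm_eq_abs]
  refine (abs_weightedAvg_le ic h2 x).trans ?_
  calc K * (|s| * ‖k‖) * ∫ y, |c + z' y| ∂μ ≤ K * (|s| * ‖k‖) * (|c| + ‖z'‖) := by gcongr
    _ = _ := by ring

/-- The interpolation estimate for derivatives of Gaussian averages of Hölder functions. -/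
theorem abs_weightedAvg_affine_mul_sub_le (h0 : μ[id] = 0) (hc : Continuous f)
    {L α δ : ℝ} (hα0 : 0 ≤ α) (hα1 : α ≤ 1) (hδ : 0 < δ) (hL : 0 ≤ L)
    (hB : ∀ x, |f x| ≤ B) (hf : ∀ x y, |f x - f y| ≤ L * ‖x - y‖ ^ α)
    (c : ℝ) {z z' : Lp ℝ 2 μ} (hz : z ∈ closure (Set.range (innerL2 μ)))
    (hz' : z' ∈ closure (Set.range (innerL2 μ))) (x : H) :
    |weightedAvg μ (fun y => (c + z' y) * z y - ⟪z', z⟫) f x| ≤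
      L * δ ^ α * (|c| * ‖z‖ + 2 * (‖z'‖ * ‖z‖)) +
        L * δ ^ (α - 1) * ‖(innerL2 μ).adjoint z‖ * (|c| + ‖z'‖) := by
  obtain ⟨g, hgB, hgl, hfg⟩ := exists_lipschitz_approx hα0 hα1 hδ hL hB hf
  have hK : 0 ≤ L * δ ^ (α - 1) := by positivity
  have hgc : Continuous g :=
    (LipschitzWith.of_dist_le_mul (K := (L * δ ^ (α - 1)).toNNReal) fun x y => by
      rw [Real.coe_toNNReal _ hK, Real.dist_eq, dist_eq_norm]
      exact hgl x y).continuous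
  have iψ := integrable_affine_mul_sub_inner c z' z
  have h1 := weightedAvg_sub_fun iψ hc hB hgc hgB x
  have h2 := abs_weightedAvg_le iψ hfg x
  have h3 := abs_weightedAvg_affine_mul_sub_le_of_lipschitz h0 hK hgB hgl c hz hz' x
  have h4 : L * δ ^ α * ∫ y, |(c + z' y) * z y - ⟪z', z⟫| ∂μ ≤
      L * δ ^ α * (|c| * ‖z‖ + 2 * (‖z'‖ * ‖z‖)) := by
    gcongr
    exact integral_abs_affine_mul_sub_inner_le c z' z
  rw [h1] at h2
  have h5 := abs_sub_abs_le_abs_sub (weightedAvg μ (fun y => (c + z' y) * z y - ⟪z', z⟫) f x)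
    (weightedAvg μ (fun y => (c + z' y) * z y - ⟪z', z⟫) g x)
  linarith

end Gaussian

end OU

/-! ### The function `h`, the weighted norms, and the semigroup `Q_t` in coordinates. -/

namespace OU

open Filter Topology

section Hfun

variable {u : ℝ}

lemma hfun_of_pos (hu : 0 < u) : hfun u = 2 * u / (Real.exp (2 * u) - 1) := if_neg hu.ne'

lemma exp_two_mul_sub_one_pos (hu : 0 < u) : 0 < Real.exp (2 * u) - 1 := by
  have := Real.add_one_lt_exp (x := 2 * u) (by positivity)
  linarith

lemma hfun_nonneg (hu : 0 < u) : 0 ≤ hfun u := by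
  have := exp_two_mul_sub_one_pos hu
  rw [hfun_of_pos hu]
  positivity

lemma hfun_le_one (hu : 0 < u) : hfun u ≤ 1 := by
  rw [hfun_of_pos hu, div_le_one (exp_two_mul_sub_one_pos hu)]
  linarith [Real.add_one_le_exp (2 * u)]

lemma exp_neg_sq_le_hfun (hu : 0 < u) : Real.exp (-u) ^ 2 ≤ hfun u := by
  rw [hfun_of_pos hu, le_div_iff₀ (exp_two_mul_sub_one_pos hu), ← Real.exp_nat_mul, mul_sub,
    ← Real.exp_add]
  have h := Real.add_one_le_exp (-(2 * u))
  have e1 : (2 : ℕ) * -u + 2 * u = 0 := by push_cast; ring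
  have e2 : (2 : ℕ) * -u = -(2 * u) := by push_cast; ring
  rw [e1, e2, Real.exp_zero]
  linarith

/-- Factoring `exp (2u) - 1 = (exp u + 1) (exp u - 1)`. The prefactor is at most `1` and at most `2
exp (-u)`, which gives the two comparisons of norms at times `t` and `t / 2`. -/
lemma hfun_eq_mul_hfun_half (hu : 0 < u) : hfun u = 2 / (Real.exp u + 1) * hfun (u / 2) := by
  have h1 := exp_two_mul_sub_one_pos (half_pos hu)
  rw [hfun_of_pos hu, hfun_of_pos (half_pos hu), mul_div_cancel₀ u two_ne_zero] at *
  have h2 : Real.exp (2 * u) - 1 = (Real.exp u + 1) * (Real.exp u - 1) := by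
    rw [two_mul, Real.exp_add]; ring
  rw [h2]
  have h3 : 0 < Real.exp u + 1 := by positivity
  field_simp

lemma hfun_le_hfun_half (hu : 0 < u) : hfun u ≤ hfun (u / 2) := by
  rw [hfun_eq_mul_hfun_half hu]
  refine mul_le_of_le_one_left (hfun_nonneg (half_pos hu)) ?_
  rw [div_le_one (by positivity)]
  linarith [Real.add_one_le_exp u]

lemma hfun_le_two_mul_exp_mul_hfun_half (hu : 0 < u) :
    hfun u ≤ 2 * (Real.exp (-(u / 2)) ^ 2 * hfun (u / 2)) := by
  rw [hfun_eq_mul_hfun_half hu, ← mul_assoc]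
  refine mul_le_mul_of_nonneg_right ?_ (hfun_nonneg (half_pos hu))
  rw [← Real.exp_nat_mul, show (2 : ℕ) * -(u / 2) = -u by push_cast; ring, Real.exp_neg,
    div_eq_mul_inv]
  gcongr
  linarith

/-- The last factor is the variance at time `t` of a coordinate when `a` is the identity. Hence
`|w|_t² / t` is then exactly the squared Cameron-Martin norm of `Q_t w`, which explains the choice
of `h`. -/
lemma exp_neg_sq_eq_hfun_mul {l t : ℝ} (hl : 0 < l) (ht : 0 < t) :
    Real.exp (-(l * t)) ^ 2 = hfun (l * t) / t * ((1 - Real.exp (-(2 * l * t))) / (2 * l)) := by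
  have h1 := exp_two_mul_sub_one_pos (mul_pos hl ht)
  rw [hfun_of_pos (mul_pos hl ht), ← Real.exp_nat_mul,
    show ((2 : ℕ) : ℝ) * -(l * t) = -(2 * (l * t)) by push_cast; ring, mul_assoc 2 l t]
  have h2 : (1 - Real.exp (-(2 * (l * t)))) =
      Real.exp (-(2 * (l * t))) * (Real.exp (2 * (l * t)) - 1) := by
    rw [mul_sub, ← Real.exp_add]; simp
  rw [h2]
  generalize Real.exp (2 * (l * t)) - 1 = d at h1
  field_simp

end Hfun

/-! ### Coordinate estimates for `Q_t` and a lower bound on the covariance. -/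

section Basis

variable {H : Type*} [NormedAddCommGroup H] [InnerProductSpace ℝ H]
  (ε : HilbertBasis ℕ ℝ H) {lam : ℕ → ℝ} {t : ℝ}

lemma hasSum_sq_inner (w : H) : HasSum (fun i => ⟪ε i, w⟫ ^ 2) (‖w‖ ^ 2) := by
  have := ε.hasSum_inner_mul_inner w w
  rw [real_inner_self_eq_norm_sq] at this
  refine this.congr_fun fun i => ?_
  rw [real_inner_comm, sq]

lemma ext_inner_basis {x y : H} (h : ∀ i, ⟪ε i, x⟫ = ⟪ε i, y⟫) : x = y := by
  apply ε.repr.injective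
  ext i
  rw [ε.repr_apply_apply, ε.repr_apply_apply, h]

lemma exp_neg_mul_le_one (hl : ∀ i, 0 < lam i) (ht : 0 ≤ t) (i : ℕ) :
    Real.exp (-(lam i * t)) ≤ 1 := by
  rw [Real.exp_le_one_iff, neg_nonpos]
  exact mul_nonneg (hl i).le ht

lemma sq_exp_mul_le (hl : ∀ i, 0 < lam i) (ht : 0 ≤ t) (i : ℕ) (r : ℝ) :
    (Real.exp (-(lam i * t)) * r) ^ 2 ≤ r ^ 2 := by
  rw [mul_pow]
  exact mul_le_of_le_one_left (sq_nonneg _)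
    (pow_le_one₀ (Real.exp_nonneg _) (exp_neg_mul_le_one hl ht i))

lemma exists_hasSum_Q (hl : ∀ i, 0 < lam i) (ht : 0 ≤ t) (w : H) :
    ∃ q, HasSum (fun i => (Real.exp (-(lam i * t)) * ⟪ε i, w⟫) • ε i) q ∧
      ∀ i, ⟪ε i, q⟫ = Real.exp (-(lam i * t)) * ⟪ε i, w⟫ := by
  have hm : Memℓp (fun i => Real.exp (-(lam i * t)) * ⟪ε i, w⟫) 2 := by
    refine memℓp_gen ?_
    refine Summable.of_nonneg_of_le (fun i => by positivity) (fun i => ?_)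
      (hasSum_sq_inner ε w).summable
    have := sq_exp_mul_le hl ht i ⟪ε i, w⟫
    rw [← sq_abs] at this
    exact_mod_cast this
  let c : lp (fun _ : ℕ => ℝ) 2 := ⟨_, hm⟩
  refine ⟨ε.repr.symm c, ε.hasSum_repr_symm c, fun i => ?_⟩
  rw [← ε.repr_apply_apply, LinearIsometryEquiv.apply_symm_apply]

lemma hasSum_Q (hl : ∀ i, 0 < lam i) (ht : 0 ≤ t) (w : H) :
    HasSum (fun i => (Real.exp (-(lam i * t)) * ⟪ε i, w⟫) • ε i) (Q ε lam t w) := by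
  obtain ⟨q, hq, -⟩ := exists_hasSum_Q ε hl ht w
  exact hq.summable.hasSum

lemma inner_basis_Q (hl : ∀ i, 0 < lam i) (ht : 0 ≤ t) (w : H) (i : ℕ) :
    ⟪ε i, Q ε lam t w⟫ = Real.exp (-(lam i * t)) * ⟪ε i, w⟫ := by
  obtain ⟨q, hq, h⟩ := exists_hasSum_Q ε hl ht w
  rw [← h i, Q, hq.tsum_eq]

lemma Q_add_smul (hl : ∀ i, 0 < lam i) (ht : 0 ≤ t) (x w : H) (s : ℝ) :
    Q ε lam t (x + s • w) = Q ε lam t x + s • Q ε lam t w := by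
  refine ext_inner_basis ε fun i => ?_
  simp only [inner_add_right, inner_smul_right, inner_basis_Q ε hl ht]
  ring

lemma norm_Q_le (hl : ∀ i, 0 < lam i) (ht : 0 ≤ t) (w : H) : ‖Q ε lam t w‖ ≤ ‖w‖ := by
  rw [← sq_le_sq₀ (norm_nonneg _) (norm_nonneg _)]
  refine hasSum_le (fun i => ?_) (hasSum_sq_inner ε _) (hasSum_sq_inner ε w)
  rw [inner_basis_Q ε hl ht]
  exact sq_exp_mul_le hl ht i _

lemma continuous_Q (hl : ∀ i, 0 < lam i) (ht : 0 ≤ t) : Continuous (Q ε lam t) := by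
  refine (LipschitzWith.of_dist_le_mul (K := 1) fun x y => ?_).continuous
  rw [NNReal.coe_one, one_mul, dist_eq_norm, dist_eq_norm]
  have h := Q_add_smul ε hl ht x y (-1)
  simp only [neg_smul, one_smul, ← sub_eq_add_neg] at h
  rw [← h]
  exact norm_Q_le ε hl ht _

lemma inner_Q_left (hl : ∀ i, 0 < lam i) (ht : 0 ≤ t) (x y : H) :
    ⟪Q ε lam t x, y⟫ = ⟪x, Q ε lam t y⟫ := by
  refine (ε.hasSum_inner_mul_inner (Q ε lam t x) y).unique ?_
  refine (ε.hasSum_inner_mul_inner x (Q ε lam t y)).congr_fun fun i => ?_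
  rw [inner_basis_Q ε hl ht, real_inner_comm, inner_basis_Q ε hl ht, real_inner_comm x]
  ring

lemma wnorm_nonneg (w : H) : 0 ≤ wnorm ε lam t w := Real.sqrt_nonneg _

lemma hasSum_wnorm_sq (hl : ∀ i, 0 < lam i) (ht : 0 < t) (w : H) :
    HasSum (fun i => ⟪ε i, w⟫ ^ 2 * hfun (lam i * t)) (wnorm ε lam t w ^ 2) := by
  have h0 : ∀ i, 0 ≤ ⟪ε i, w⟫ ^ 2 * hfun (lam i * t) := fun i =>
    mul_nonneg (sq_nonneg _) (hfun_nonneg (mul_pos (hl i) ht))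
  rw [wnorm, Real.sq_sqrt (tsum_nonneg h0)]
  refine (Summable.of_nonneg_of_le h0 (fun i => ?_) (hasSum_sq_inner ε w).summable).hasSum
  exact mul_le_of_le_one_right (sq_nonneg _) (hfun_le_one (mul_pos (hl i) ht))

lemma wnorm_le_norm (hl : ∀ i, 0 < lam i) (ht : 0 < t) (w : H) : wnorm ε lam t w ≤ ‖w‖ := by
  rw [← sq_le_sq₀ (wnorm_nonneg ε w) (norm_nonneg _)]
  refine hasSum_le (fun i => ?_) (hasSum_wnorm_sq ε hl ht w) (hasSum_sq_inner ε w)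
  exact mul_le_of_le_one_right (sq_nonneg _) (hfun_le_one (mul_pos (hl i) ht))

lemma norm_Q_le_wnorm (hl : ∀ i, 0 < lam i) (ht : 0 < t) (w : H) :
    ‖Q ε lam t w‖ ≤ wnorm ε lam t w := by
  rw [← sq_le_sq₀ (norm_nonneg _) (wnorm_nonneg ε w)]
  refine hasSum_le (fun i => ?_) (hasSum_sq_inner ε _) (hasSum_wnorm_sq ε hl ht w)
  rw [inner_basis_Q ε hl ht.le, mul_pow, mul_comm]
  exact mul_le_mul_of_nonneg_left (exp_neg_sq_le_hfun (mul_pos (hl i) ht)) (sq_nonneg _)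

lemma wnorm_Q_le_wnorm {s : ℝ} (hl : ∀ i, 0 < lam i) (hs : 0 < s) (ht : 0 ≤ t) (w : H) :
    wnorm ε lam s (Q ε lam t w) ≤ wnorm ε lam s w := by
  rw [← sq_le_sq₀ (wnorm_nonneg ε _) (wnorm_nonneg ε w)]
  refine hasSum_le (fun i => ?_) (hasSum_wnorm_sq ε hl hs _) (hasSum_wnorm_sq ε hl hs w)
  rw [inner_basis_Q ε hl ht]
  exact mul_le_mul_of_nonneg_right (sq_exp_mul_le hl ht i _) (hfun_nonneg (mul_pos (hl i) hs))

lemma wnorm_le_wnorm_half (hl : ∀ i, 0 < lam i) (ht : 0 < t) (w : H) :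
    wnorm ε lam t w ≤ wnorm ε lam (t / 2) w := by
  rw [← sq_le_sq₀ (wnorm_nonneg ε _) (wnorm_nonneg ε w)]
  refine hasSum_le (fun i => ?_) (hasSum_wnorm_sq ε hl ht _) (hasSum_wnorm_sq ε hl (half_pos ht) w)
  rw [← mul_div_assoc]
  exact mul_le_mul_of_nonneg_left (hfun_le_hfun_half (mul_pos (hl i) ht)) (sq_nonneg _)

lemma wnorm_le_two_mul_wnorm_Q_half (hl : ∀ i, 0 < lam i) (ht : 0 < t) (w : H) :
    wnorm ε lam t w ≤ 2 * wnorm ε lam (t / 2) (Q ε lam (t / 2) w) := by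
  have h0 := wnorm_nonneg ε (lam := lam) (t := t / 2) (Q ε lam (t / 2) w)
  have h1 : wnorm ε lam t w ^ 2 ≤ 2 * wnorm ε lam (t / 2) (Q ε lam (t / 2) w) ^ 2 := by
    refine hasSum_le (fun i => ?_) (hasSum_wnorm_sq ε hl ht _)
      ((hasSum_wnorm_sq ε hl (half_pos ht) (Q ε lam (t / 2) w)).mul_left 2)
    rw [inner_basis_Q ε hl (half_pos ht).le, ← mul_div_assoc]
    have := mul_le_mul_of_nonneg_left
      (hfun_le_two_mul_exp_mul_hfun_half (mul_pos (hl i) ht)) (sq_nonneg ⟪ε i, w⟫)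
    linarith
  refine abs_le_of_sq_le_sq' ?_ (by positivity) |>.2
  -- The squared inequality gives the factor `√2`, rounded up to `2`.
  nlinarith [sq_nonneg (wnorm ε lam (t / 2) (Q ε lam (t / 2) w))]

variable {a : H →L[ℝ] H} {γ : ℝ}

lemma intervalIntegrable_inner_Q (hl : ∀ i, 0 < lam i) (ht : 0 ≤ t) (h : H) :
    IntervalIntegrable (fun r => ⟪Q ε lam (t - r) h, a (Q ε lam (t - r) h)⟫) volume 0 t := by
  rw [intervalIntegrable_iff_integrableOn_Ioc_of_le ht]
  -- Only `r ≤ t` is considered: at negative times the series defining `Q` may diverge, and `tsum`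
  -- then takes the value `0`.
  have hq : AEStronglyMeasurable (fun r => Q ε lam (t - r) h) (volume.restrict (Set.Ioc 0 t)) := by
    refine aestronglyMeasurable_of_tendsto_ae atTop
      (f := fun (n : ℕ) r => ∑ i ∈ Finset.range n,
        (Real.exp (-(lam i * (t - r))) * ⟪ε i, h⟫) • ε i) (fun n => ?_) ?_
    · exact Continuous.aestronglyMeasurable (by fun_prop)
    · filter_upwards [ae_restrict_mem measurableSet_Ioc] with r hr
      exact (hasSum_Q ε hl (sub_nonneg.2 hr.2) h).tendsto_sum_nat
  refine Integrable.mono' (g := fun _ => ‖h‖ * (‖a‖ * ‖h‖)) (integrable_const _)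
    (hq.inner (a.continuous.comp_aestronglyMeasurable hq)) ?_
  filter_upwards [ae_restrict_mem measurableSet_Ioc] with r hr
  have h1 := norm_Q_le ε hl (sub_nonneg.2 hr.2) h
  refine (abs_real_inner_le_norm _ _).trans ?_
  gcongr
  exact (a.le_opNorm _).trans (by gcongr)

lemma integral_exp_sq_sub {l t : ℝ} (hl : 0 < l) :
    ∫ r in (0 : ℝ)..t, Real.exp (-(l * (t - r))) ^ 2 =
      (1 - Real.exp (-(2 * l * t))) / (2 * l) := by
  have hd : ∀ r : ℝ, HasDerivAt (fun r => Real.exp (-(2 * l * (t - r))) / (2 * l))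
      (Real.exp (-(l * (t - r))) ^ 2) r := by
    intro r
    have h1 : HasDerivAt (fun r : ℝ => -(2 * l * (t - r))) (2 * l) r := by
      exact (((hasDerivAt_id' r).const_sub t).const_mul (2 * l)).neg.congr_deriv (by ring)
    refine (h1.exp.div_const (2 * l)).congr_deriv ?_
    rw [← Real.exp_nat_mul, mul_div_cancel_right₀ _ (by positivity)]
    congr 1
    push_cast
    ring
  rw [intervalIntegral.integral_eq_sub_of_hasDerivAt (fun r _ => hd r)
    (Continuous.intervalIntegrable (by fun_prop) _ _)]
  simp [sub_div]

/-- Ellipticity reduces to `γ ‖Q_{t-r} h‖²`, whose coordinates integrate explicitly. Finite partial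
sums avoid exchanging series and integral. -/
lemma sum_le_integral_inner_Q (hl : ∀ i, 0 < lam i) (ht : 0 ≤ t) (hγ : 0 < γ)
    (ha : ∀ z, γ * ‖z‖ ^ 2 ≤ ⟪z, a z⟫) (h : H) (s : Finset ℕ) :
    γ * ∑ i ∈ s, ⟪ε i, h⟫ ^ 2 * ((1 - Real.exp (-(2 * lam i * t))) / (2 * lam i)) ≤
      ∫ r in (0 : ℝ)..t, ⟪Q ε lam (t - r) h, a (Q ε lam (t - r) h)⟫ := by
  have hi : ∀ i, IntervalIntegrable (fun r => ⟪ε i, h⟫ ^ 2 * Real.exp (-(lam i * (t - r))) ^ 2)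
      volume 0 t := fun i => Continuous.intervalIntegrable (by fun_prop) _ _
  have h1 : γ * ∑ i ∈ s, ⟪ε i, h⟫ ^ 2 * ((1 - Real.exp (-(2 * lam i * t))) / (2 * lam i)) =
      ∫ r in (0 : ℝ)..t, γ * ∑ i ∈ s, ⟪ε i, h⟫ ^ 2 * Real.exp (-(lam i * (t - r))) ^ 2 := by
    rw [intervalIntegral.integral_const_mul, intervalIntegral.integral_finsetSum fun i _ => hi i]
    simp_rw [intervalIntegral.integral_const_mul, integral_exp_sq_sub (hl _)]
  rw [h1]
  refine intervalIntegral.integral_mono_on ht (Continuous.intervalIntegrable (by fun_prop) _ _)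
    (intervalIntegrable_inner_Q ε hl ht h) fun r hr => le_trans ?_ (ha _)
  refine mul_le_mul_of_nonneg_left ?_ hγ.le
  refine le_trans (le_of_eq ?_) (sum_le_hasSum s (fun i _ => sq_nonneg _)
    (hasSum_sq_inner ε (Q ε lam (t - r) h)))
  refine Finset.sum_congr rfl fun i _ => ?_
  rw [inner_basis_Q ε hl (sub_nonneg.2 hr.2), mul_pow, mul_comm]

/-- `Q_t w` belongs to the Cameron-Martin space of the law of the Ornstein-Uhlenbeck process at
time `t`, with norm at most `(γ t)^{-1/2} |w|_t`. -/
lemma inner_Q_sq_le (hl : ∀ i, 0 < lam i) (ht : 0 < t) (hγ : 0 < γ)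
    (ha : ∀ z, γ * ‖z‖ ^ 2 ≤ ⟪z, a z⟫) (w h : H) :
    ⟪Q ε lam t w, h⟫ ^ 2 ≤ wnorm ε lam t w ^ 2 / (γ * t) *
      ∫ r in (0 : ℝ)..t, ⟪Q ε lam (t - r) h, a (Q ε lam (t - r) h)⟫ := by
  have hsum := (ε.hasSum_inner_mul_inner (Q ε lam t w) h).tendsto_sum_nat.pow 2
  refine le_of_tendsto' hsum fun n => ?_
  have hE : ∀ i, 0 ≤ (1 - Real.exp (-(2 * lam i * t))) / (2 * lam i) := fun i => by
    have h1 := hl i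
    have : Real.exp (-(2 * lam i * t)) ≤ 1 := Real.exp_le_one_iff.2 (neg_nonpos.2 (by positivity))
    exact div_nonneg (by linarith) (by positivity)
  have hD : ∀ i, 0 ≤ hfun (lam i * t) := fun i => hfun_nonneg (mul_pos (hl i) ht)
  -- Cauchy-Schwarz with weights chosen so that, by `exp_neg_sq_eq_hfun_mul`, each squared term
  -- equals the product of the two factors.
  have hCS := Finset.sum_sq_le_sum_mul_sum_of_sq_le_mul (Finset.range n)
    (r := fun i => ⟪Q ε lam t w, ε i⟫ * ⟪ε i, h⟫)
    (f := fun i => ⟪ε i, w⟫ ^ 2 * hfun (lam i * t) / t)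
    (g := fun i => ⟪ε i, h⟫ ^ 2 * ((1 - Real.exp (-(2 * lam i * t))) / (2 * lam i)))
    (fun i _ => div_nonneg (mul_nonneg (sq_nonneg _) (hD i)) ht.le)
    (fun i _ => mul_nonneg (sq_nonneg _) (hE i))
    (fun i _ => by
      rw [real_inner_comm, inner_basis_Q ε hl ht.le, mul_pow, mul_pow,
        exp_neg_sq_eq_hfun_mul (hl i) ht]
      exact le_of_eq (by ring))
  refine hCS.trans ?_
  have h1 : ∑ i ∈ Finset.range n, ⟪ε i, w⟫ ^ 2 * hfun (lam i * t) / t ≤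
      wnorm ε lam t w ^ 2 / t := by
    rw [← Finset.sum_div]
    gcongr
    exact sum_le_hasSum _ (fun i _ => mul_nonneg (sq_nonneg _) (hD i)) (hasSum_wnorm_sq ε hl ht w)
  have h2 := sum_le_integral_inner_Q ε hl ht.le hγ ha h (Finset.range n)
  rw [← le_div_iff₀' hγ] at h2
  refine (mul_le_mul h1 h2 (Finset.sum_nonneg fun i _ => mul_nonneg (sq_nonneg _) (hE i))
    (by positivity)).trans (le_of_eq ?_)
  field_simp

end Basis

end OU

/-! ### Directional derivatives and the Ornstein-Uhlenbeck semigroup. -/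

namespace OU

open Filter Topology

section Derivatives

variable {H : Type*} [NormedAddCommGroup H] [InnerProductSpace ℝ H] [CompleteSpace H]
  [SecondCountableTopology H] [MeasurableSpace H] [BorelSpace H]
  {μ : Measure H} [IsGaussian μ] {f : H → ℝ} {B : ℝ}

/-- The directional derivative of `x ↦ T_φ f (S x)` with `S` linear, `T_φ f` a Gaussian average
with affine weight `φ`, and `S w` in the Cameron-Martin space. -/
lemma dirDeriv_weightedAvg_comp (h0 : μ[id] = 0) (hf : Continuous f) (hB : ∀ x, |f x| ≤ B)
    (c : ℝ) {z z' : Lp ℝ 2 μ} (hz : z ∈ closure (Set.range (innerL2 μ)))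
    (hz' : z' ∈ closure (Set.range (innerL2 μ))) {S : H → H} (hS : Continuous S) {w : H}
    (hSw : ∀ x (s : ℝ), S (x + s • w) = S x + s • S w) (hzw : (innerL2 μ).adjoint z = S w) :
    DirDerivMemCb w (fun x => weightedAvg μ (fun y => c + z' y) f (S x)) ∧
      dirDeriv w (fun x => weightedAvg μ (fun y => c + z' y) f (S x)) =
        fun x => weightedAvg μ (fun y => (c + z' y) * z y - ⟪z', z⟫) f (S x) := by
  have hd : ∀ x, HasLineDerivAt ℝ (fun x => weightedAvg μ (fun y => c + z' y) f (S x))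
      (weightedAvg μ (fun y => (c + z' y) * z y - ⟪z', z⟫) f (S x)) x w := fun x => by
    have := hasDerivAt_weightedAvg h0 hf hB c hz hz' (S x)
    simpa only [HasLineDerivAt, hSw, hzw] using this
  have he : dirDeriv w (fun x => weightedAvg μ (fun y => c + z' y) f (S x)) =
      fun x => weightedAvg μ (fun y => (c + z' y) * z y - ⟪z', z⟫) f (S x) :=
    funext fun x => (hd x).lineDeriv
  refine ⟨⟨fun x => (hd x).lineDifferentiableAt, ?_⟩, he⟩
  rw [he]
  have iψ := integrable_affine_mul_sub_inner c z' z
  exact ⟨(continuous_weightedAvg iψ hf hB).comp hS, _, fun x => abs_weightedAvg_le iψ hB (S x)⟩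

end Derivatives

section Holder

variable {H : Type*} [NormedAddCommGroup H] {α : ℝ} {f : H → ℝ}

lemma holderSeminorm_nonneg : 0 ≤ holderSeminorm α f :=
  Real.sSup_nonneg (by rintro _ ⟨x, h, -, rfl⟩; positivity)

lemma MemHolder.abs_sub_le (hf : MemHolder α f) (x y : H) :
    |f x - f y| ≤ holderSeminorm α f * ‖x - y‖ ^ α := by
  rcases eq_or_ne x y with rfl | hxy
  · simpa using mul_nonneg (holderSeminorm_nonneg (f := f)) (Real.rpow_nonneg le_rfl α)
  · have hpos : 0 < ‖x - y‖ := norm_pos_iff.2 (sub_ne_zero.2 hxy)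
    rw [← div_le_iff₀ (by positivity)]
    exact le_csSup hf.2 ⟨y, x - y, sub_ne_zero.2 hxy, by rw [add_sub_cancel]⟩

lemma supNorm_le {E : Type*} [Nonempty E] {g : E → ℝ} {C : ℝ} (h : ∀ x, |g x| ≤ C) :
    supNorm g ≤ C := ciSup_le h

end Holder

section TransitionSemigroup

variable {H : Type*} [NormedAddCommGroup H] [InnerProductSpace ℝ H] {ε : HilbertBasis ℕ ℝ H}
  {lam : ℕ → ℝ}

/-- Nonnegativity of `V` gives `0 ≤ lam n`, and a zero eigenvalue would contradict injectivity of
`V`. -/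
lemma IsEigenbasis.lam_pos [CompleteSpace H] {V : H →ₗ.[ℝ] H} (hV : IsAdmissible V)
    (hε : IsEigenbasis V ε lam) (n : ℕ) : 0 < lam n := by
  obtain ⟨hn, hn'⟩ := hε.eigen n
  obtain ⟨T, -, -, hT⟩ := hV.traceClass_inverse
  have h1 : ‖ε n‖ = 1 := ε.orthonormal.1 n
  have h2 := hV.nonneg ⟨ε n, hn⟩
  rw [hn', inner_smul_left, real_inner_self_eq_norm_sq, h1] at h2
  refine lt_of_le_of_ne (by simpa using h2) fun h3 => ?_
  have h4 := hT ⟨ε n, hn⟩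
  rw [hn', ← h3, zero_smul, map_zero] at h4
  rw [show ε n = 0 from h4.symm, norm_zero] at h1
  exact zero_ne_one h1

variable [MeasurableSpace H] [BorelSpace H]
  {a : H →L[ℝ] H} {Ω : Type*} [MeasurableSpace Ω] {P : H → Measure Ω} {X : ℝ≥0 → Ω → H}

namespace IsOrnsteinUhlenbeck

lemma isGaussian_map (hX : IsOrnsteinUhlenbeck ε lam a P X) (x : H) (t : ℝ≥0) :
    IsGaussian ((P x).map (X t)) :=
  ((hX.gaussian x).hasGaussianLaw_eval t).isGaussian_map

variable [CompleteSpace H] [SecondCountableTopology H]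

lemma integral_id_map (hX : IsOrnsteinUhlenbeck ε lam a P X) (hl : ∀ i, 0 < lam i) (x : H)
    (t : ℝ≥0) : ((P x).map (X t))[id] = Q ε lam t x := by
  have := hX.isGaussian_map x t
  refine ext_inner_left ℝ fun h => ?_
  rw [← integral_inner IsGaussian.integrable_id, integral_map ((hX.gaussian x).aemeasurable t)
    (by fun_prop)]
  simp_rw [id_eq, real_inner_comm _ h]
  rw [hX.mean, inner_Q_left ε hl t.coe_nonneg]

lemma covarianceBilin_map (hX : IsOrnsteinUhlenbeck ε lam a P X) (x : H) (t : ℝ≥0) (g h : H) :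
    covarianceBilin ((P x).map (X t)) g h =
      ∫ r in (0 : ℝ)..t, ⟪Q ε lam (t - r) g, a (Q ε lam (t - r) h)⟫ := by
  have := hX.isGaussian_map x t
  rw [covarianceBilin_apply_eq_cov IsGaussian.memLp_two_id,
    covariance_map_fun (by fun_prop) (by fun_prop) ((hX.gaussian x).aemeasurable t)]
  have := hX.cov x t t g h
  rw [min_self] at this
  rw [← this]
  simp_rw [real_inner_comm]

/-- A Gaussian law is determined by its mean and covariance, and here the covariance does not
involve `x`. -/
lemma map_eq_map_add (hX : IsOrnsteinUhlenbeck ε lam a P X) (hl : ∀ i, 0 < lam i) (x : H)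
    (t : ℝ≥0) :
    (P x).map (X t) = ((P 0).map (X t)).map (fun y => Q ε lam t x + y) := by
  have := hX.isGaussian_map x t
  have := hX.isGaussian_map 0 t
  have hQ0 : Q ε lam t 0 = 0 := by simp [Q]
  refine IsGaussian.ext ?_ ?_
  · rw [hX.integral_id_map hl, integral_map (by fun_prop) (by fun_prop)]
    simp only [id_eq]
    have hi : Integrable (fun y : H => y) ((P 0).map (X t)) := IsGaussian.integrable_id
    have h0 := hX.integral_id_map hl 0 t
    simp only [id_eq] at h0
    rw [integral_add (integrable_const _) hi, h0, hQ0]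
    simp
  · rw [covarianceBilin_map_const_add]
    ext g h
    rw [hX.covarianceBilin_map, hX.covarianceBilin_map]

lemma semigroup_eq (hX : IsOrnsteinUhlenbeck ε lam a P X) (hl : ∀ i, 0 < lam i) (t : ℝ≥0)
    {f : H → ℝ} (hf : Continuous f) :
    semigroup P X t f = fun x => weightedAvg ((P 0).map (X t)) (fun _ => 1) f (Q ε lam t x) := by
  ext x
  rw [semigroup, weightedAvg, ← integral_map ((hX.gaussian x).aemeasurable t) (by fun_prop),
    hX.map_eq_map_add hl, integral_map (by fun_prop) (by fun_prop)]
  simp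

/-- The vector `Q_t w` belongs to the Cameron-Martin space of the law of `X_t`. -/
lemma exists_adjoint_eq_Q (hX : IsOrnsteinUhlenbeck ε lam a P X) (hl : ∀ i, 0 < lam i) {t : ℝ≥0}
    (ht : 0 < t) {γ : ℝ} (hγ : 0 < γ) (ha : ∀ z, γ * ‖z‖ ^ 2 ≤ ⟪z, a z⟫) (w : H) :
    ∃ z ∈ closure (Set.range (innerL2 ((P 0).map (X t)))),
      ‖z‖ ≤ wnorm ε lam t w / Real.sqrt (γ * t) ∧
        (innerL2 ((P 0).map (X t))).adjoint z = Q ε lam t w := by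
  have := hX.isGaussian_map 0 t
  have ht' : (0 : ℝ) < t := ht
  have hw := wnorm_nonneg ε (lam := lam) (t := t) w
  refine exists_mem_closure_range_adjoint_eq _ (by positivity) fun h => ?_
  have h0 : ((P 0).map (X t))[id] = 0 := by rw [hX.integral_id_map hl]; simp [Q]
  refine abs_le_of_sq_le_sq ?_ (by positivity)
  rw [mul_pow, div_pow, Real.sq_sqrt (by positivity), ← real_inner_self_eq_norm_sq,
    ← covarianceBilin_eq_inner h0, hX.covarianceBilin_map]
  exact inner_Q_sq_le ε hl ht' hγ ha w h

end IsOrnsteinUhlenbeck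

end TransitionSemigroup

lemma rpow_identities {t α : ℝ} (ht : 0 < t) :
    Real.sqrt t ^ (α - 1) = t ^ ((α - 1) / 2) ∧
      Real.sqrt t ^ α / Real.sqrt t = t ^ ((α - 1) / 2) ∧
      Real.sqrt t ^ α / Real.sqrt t ^ 2 = t ^ (α / 2 - 1) ∧
      Real.sqrt t ^ (α - 1) / Real.sqrt t = t ^ (α / 2 - 1) := by
  have hs : 0 < Real.sqrt t := Real.sqrt_pos.2 ht
  have h1 : ∀ b : ℝ, Real.sqrt t ^ b = t ^ (b / 2) := fun b => by
    rw [Real.sqrt_eq_rpow, ← Real.rpow_mul ht.le]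
    ring_nf
  refine ⟨h1 _, ?_, ?_, ?_⟩
  · rw [← Real.rpow_sub_one hs.ne', h1]
  · rw [← Real.rpow_natCast (Real.sqrt t) 2, ← Real.rpow_sub hs, h1]
    congr 1
    push_cast
    ring
  · rw [← Real.rpow_sub_one hs.ne', h1]
    congr 1
    ring

end OU

/-! ### The gradient and Hessian estimates. -/

theorem corollary3p3 (α γ : ℝ) (hα0 : 0 < α) (hα1 : α < 1) (hγ : 0 < γ) :
    ∃ c₁ : ℝ, 0 < c₁ ∧
      ∀ (H : Type*) [NormedAddCommGroup H] [InnerProductSpace ℝ H] [CompleteSpace H]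
        [TopologicalSpace.SeparableSpace H] [MeasurableSpace H] [BorelSpace H]
        (V : H →ₗ.[ℝ] H) (_ : OU.IsAdmissible V)
        (ε : HilbertBasis ℕ ℝ H) (lam : ℕ → ℝ) (_ : OU.IsEigenbasis V ε lam)
        (a : H →L[ℝ] H) (_ : OU.IsElliptic γ a)
        (Ω : Type*) [MeasurableSpace Ω] (P : H → Measure Ω) (X : ℝ≥0 → Ω → H)
        (_ : OU.IsOrnsteinUhlenbeck ε lam a P X)
        (f : H → ℝ) (_ : OU.MemHolder α f) (u w : H) (t : ℝ≥0) (_ : 0 < t),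
        OU.DirDerivMemCb w (OU.semigroup P X t f) ∧
        OU.DirDerivMemCb u (OU.dirDeriv w (OU.semigroup P X t f)) ∧
        (OU.supNorm (OU.dirDeriv w (OU.semigroup P X t f))
            ≤ c₁ * OU.wnorm ε lam t w * OU.holderSeminorm α f * (t : ℝ) ^ ((α - 1) / 2) ∧
          c₁ * OU.wnorm ε lam t w * OU.holderSeminorm α f * (t : ℝ) ^ ((α - 1) / 2)
            ≤ c₁ * ‖w‖ * OU.holderSeminorm α f * (t : ℝ) ^ ((α - 1) / 2)) ∧
        (OU.supNorm (OU.dirDeriv u (OU.dirDeriv w (OU.semigroup P X t f)))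
            ≤ c₁ * OU.wnorm ε lam (t / 2) (OU.Q ε lam (t / 2) u) * OU.wnorm ε lam (t / 2) w
                * OU.holderSeminorm α f * (t : ℝ) ^ (α / 2 - 1) ∧
          c₁ * OU.wnorm ε lam (t / 2) (OU.Q ε lam (t / 2) u) * OU.wnorm ε lam (t / 2) w
                * OU.holderSeminorm α f * (t : ℝ) ^ (α / 2 - 1)
            ≤ c₁ * OU.wnorm ε lam (t / 2) u * OU.wnorm ε lam (t / 2) w
                * OU.holderSeminorm α f * (t : ℝ) ^ (α / 2 - 1) ∧
          c₁ * OU.wnorm ε lam (t / 2) u * OU.wnorm ε lam (t / 2) w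
                * OU.holderSeminorm α f * (t : ℝ) ^ (α / 2 - 1)
            ≤ c₁ * ‖u‖ * ‖w‖ * OU.holderSeminorm α f * (t : ℝ) ^ (α / 2 - 1)) := by
  set g : ℝ := (Real.sqrt γ)⁻¹ with hg
  have hg0 : 0 < g := inv_pos.2 (Real.sqrt_pos.2 hγ)
  -- `g + 1` serves the first derivative and `2 * (2 * g ^ 2 + g)` the second; the outer factor `2`
  -- comes from `|u|_t ≤ 2 |Q_{t/2} u|_{t/2}`.
  refine ⟨(g + 1) + 2 * (2 * g ^ 2 + g), by positivity, ?_⟩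
  intro H _ _ _ _ _ _ V hV ε lam hε a ha Ω _ P X hX f hf u w t ht
  have : SecondCountableTopology H := UniformSpace.secondCountable_of_separable H
  have hl : ∀ i, 0 < lam i := hε.lam_pos hV
  have ht' : (0 : ℝ) < t := ht
  have hs : 0 < Real.sqrt t := Real.sqrt_pos.2 ht'
  have hG := hX.isGaussian_map 0 t
  set μ := (P 0).map (X t) with hμ
  have h0 : μ[id] = 0 := by rw [hX.integral_id_map hl]; simp [OU.Q]
  obtain ⟨⟨hfc, B, hB⟩, -⟩ := id hf
  set L := OU.holderSeminorm α f with hL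
  have hL0 : 0 ≤ L := OU.holderSeminorm_nonneg
  have hfL : ∀ x y, |f x - f y| ≤ L * ‖x - y‖ ^ α := hf.abs_sub_le
  obtain ⟨zw, hzw, hzwn, hzwa⟩ := hX.exists_adjoint_eq_Q hl ht hγ ha.lower w
  obtain ⟨zu, hzu, hzun, hzua⟩ := hX.exists_adjoint_eq_Q hl ht hγ ha.lower u
  have hQc := OU.continuous_Q ε hl ht'.le
  have hQl := OU.Q_add_smul ε hl ht'.le
  -- The weight `1` is the affine weight with `c = 1`, `z' = 0`. Its derivative has weight `zw`,
  -- again affine with `c = 0`, so the same lemma differentiates twice.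
  have hz0 : (0 : Lp ℝ 2 μ) ∈ closure (Set.range (OU.innerL2 μ)) :=
    subset_closure ⟨0, map_zero _⟩
  have hzero := Lp.coeFn_zero ℝ 2 μ
  have e1 : OU.weightedAvg μ (fun _ => 1) f =
      OU.weightedAvg μ (fun y => 1 + (0 : Lp ℝ 2 μ) y) f := by
    refine OU.weightedAvg_congr ?_
    filter_upwards [hzero] with y hy
    rw [hy]; simp
  have e2 : OU.weightedAvg μ (fun y => (1 + (0 : Lp ℝ 2 μ) y) * zw y - ⟪0, zw⟫) f =
      OU.weightedAvg μ (fun y => 0 + zw y) f := by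
    refine OU.weightedAvg_congr ?_
    filter_upwards [hzero] with y hy
    rw [hy]; simp
  obtain ⟨d1, d1e⟩ := OU.dirDeriv_weightedAvg_comp h0 hfc hB 1 hzw hz0 hQc
    (fun x s => hQl x w s) hzwa
  obtain ⟨d2, d2e⟩ := OU.dirDeriv_weightedAvg_comp h0 hfc hB 0 hzu hzw hQc
    (fun x s => hQl x u s) hzua
  rw [← e1, ← hX.semigroup_eq hl t hfc] at d1 d1e
  have d1e' := d1e
  rw [e2] at d1e'
  rw [← d1e'] at d2 d2e
  have hW0 := OU.wnorm_nonneg ε (lam := lam) (t := t) w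
  have hWn := OU.wnorm_le_norm ε hl ht' w
  have hW2 := OU.wnorm_le_wnorm_half ε hl ht' w
  have hW2n := OU.wnorm_le_norm ε hl (half_pos ht') w
  have hU2 := OU.wnorm_le_two_mul_wnorm_Q_half ε hl ht' u
  have hUQ := OU.wnorm_Q_le_wnorm ε hl (half_pos ht') (half_pos ht').le u
  have hUn := OU.wnorm_le_norm ε hl (half_pos ht') u
  have hQw := OU.norm_Q_le_wnorm ε hl ht' w
  have hQu := OU.norm_Q_le_wnorm ε hl ht' u
  have hU0 := OU.wnorm_nonneg ε (lam := lam) (t := t) u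
  have hUQ0 := OU.wnorm_nonneg ε (lam := lam) (t := (t / 2 : ℝ)) (OU.Q ε lam (t / 2) u)
  have hW20 := OU.wnorm_nonneg ε (lam := lam) (t := (t / 2 : ℝ)) w
  obtain ⟨p1, p2, p3, p4⟩ := OU.rpow_identities (α := α) ht'
  have hσ : ∀ r : ℝ, r / Real.sqrt (γ * t) = g * r / Real.sqrt t := fun r => by
    rw [Real.sqrt_mul hγ.le, hg]
    field_simp
  rw [hσ] at hzwn hzun
  refine ⟨d1, d2, ⟨?_, by gcongr⟩, ?_, by gcongr, by gcongr⟩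
  · refine OU.supNorm_le fun x => ?_
    rw [d1e]
    -- Interpolation at scale `δ = √t`, passed through `hs`: since `‖zw‖` is of order `|w|_t / √t`,
    -- both terms scale as `t ^ ((α - 1) / 2)`.
    refine (OU.abs_weightedAvg_affine_mul_sub_le h0 hfc hα0.le hα1.le hs hL0 hB hfL 1 hzw hz0
      _).trans ?_
    rw [hzwa, norm_zero, zero_mul, mul_zero, add_zero, add_zero, abs_one, one_mul, mul_one]
    calc L * Real.sqrt t ^ α * ‖zw‖ + L * Real.sqrt t ^ (α - 1) * ‖OU.Q ε lam t w‖
        ≤ L * Real.sqrt t ^ α * (g * OU.wnorm ε lam t w / Real.sqrt t) +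
          L * Real.sqrt t ^ (α - 1) * OU.wnorm ε lam t w := by gcongr
      _ = (g + 1) * OU.wnorm ε lam t w * L * (t : ℝ) ^ ((α - 1) / 2) := by
          rw [← p1, ← (p2.trans p1.symm)]
          ring
      _ ≤ _ := by
          have hc := le_add_of_nonneg_right (a := g + 1) (b := 2 * (2 * g ^ 2 + g)) (by positivity)
          have := mul_le_mul_of_nonneg_right hc hW0
          gcongr ?_ * _ * _
  · refine OU.supNorm_le fun x => ?_
    rw [d2e]
    refine (OU.abs_weightedAvg_affine_mul_sub_le h0 hfc hα0.le hα1.le hs hL0 hB hfL 0 hzu hzw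
      _).trans ?_
    rw [hzua, abs_zero, zero_mul, zero_add, zero_add]
    set W := OU.wnorm ε lam t w
    set U := OU.wnorm ε lam t u
    calc L * Real.sqrt t ^ α * (2 * (‖zw‖ * ‖zu‖)) +
          L * Real.sqrt t ^ (α - 1) * ‖OU.Q ε lam t u‖ * ‖zw‖
        ≤ L * Real.sqrt t ^ α * (2 * ((g * W / Real.sqrt t) * (g * U / Real.sqrt t))) +
          L * Real.sqrt t ^ (α - 1) * U * (g * W / Real.sqrt t) := by gcongr
      _ = 2 * g ^ 2 * U * W * L * (Real.sqrt t ^ α / Real.sqrt t ^ 2) +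
          g * U * W * L * (Real.sqrt t ^ (α - 1) / Real.sqrt t) := by ring
      _ = (2 * g ^ 2 + g) * U * W * L * (t : ℝ) ^ (α / 2 - 1) := by
          rw [p3, p4]
          ring
      -- Passage from time `t` to `t / 2`: `u` goes through `Q_{t/2}` at the cost of a factor `2`,
      -- while `w` only needs `|w|_t ≤ |w|_{t/2}`.
      _ ≤ (2 * g ^ 2 + g) * (2 * OU.wnorm ε lam (t / 2) (OU.Q ε lam (t / 2) u)) *
          OU.wnorm ε lam (t / 2) w * L * (t : ℝ) ^ (α / 2 - 1) := by gcongr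
      _ = (2 * (2 * g ^ 2 + g)) * OU.wnorm ε lam (t / 2) (OU.Q ε lam (t / 2) u) *
          OU.wnorm ε lam (t / 2) w * L * (t : ℝ) ^ (α / 2 - 1) := by ring
      _ ≤ _ := by
          gcongr
          exact le_add_of_nonneg_left (by positivity)
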